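/- Let $\mathcal H_A,\mathcal H_B$ be nonzero finite-dimensional Hilbert spaces of dimensions $d_A,d_B$, let $\lambda_1,\dots,\lambda_{d_A}$ be pairwise distinct complex numbers of modulus $1$, and let $\Lambda$ be the set of unitary operators on $\mathcal H_A$ with spectrum $\{\lambda_1,\dots,\lambda_{d_A}\}$. Write $U_A$ also for $U_A\otimes 1_B$. For a state (density operator) $\rho$ on $\mathcal H_A\otimes\mathcal H_B$ define the Bures discord of response $$D_R^\Lambda(\rho)=1-\max_{U_A\in\Lambda}\operatorname{Tr}\sqrt{\sqrt\rho\,U_A\rho U_A^\dagger\sqrt\rho},$$ and for a unit vector $\phi\in\mathcal H_A\otimes\mathcal H_B$ define the entanglement of response $$E_R^\Lambda(\phi)=1-\max_{U_A\in\Lambda}F\big(|\phi\rangle\langle\phi|,\,U_A|\phi\rangle\langle\phi|U_A^\dagger\big),\qquad F(\rho,\sigma)=\Big(\operatorname{Tr}\sqrt{\sqrt\rho\,\sigma\sqrt\rho}\Big)^2,$$ where $F(|\phi\rangle\langle\phi|,U_A|\phi\rangle\langle\phi|U_A^\dagger)=|\langle\phi|U_A\phi\rangle|^2$. The maxima exist,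 $0\le D_R^\Lambda(\rho)\le1$ for every state $\rho$, and $D_R^\Lambda$ is a bona fide measure of quantum correlations: (I) $D_R^\Lambda(\rho)=0$ if and only if $\rho$ is classical-quantum, i.e. $\rho=\sum_i p_i|i\rangle\langle i|\otimes\rho_B^{(i)}$ for some orthonormal basis $\{|i\rangle\}$ of $\mathcal H_A$, probabilities $p_i$ and states $\rho_B^{(i)}$ on $\mathcal H_B$; (II) $D_R^\Lambda\big((V\otimes W)\rho(V\otimes W)^\dagger\big)=D_R^\Lambda(\rho)$ for all unitaries $V$ on $\mathcal H_A$ and $W$ on $\mathcal H_B$; (III) $D_R^\Lambda\big((\mathrm{id}_A\otimes\Phi)(\rho)\big)\le D_R^\Lambda(\rho)$ for every completely positive trace-preserving map $\Phi$ from the operators on $\mathcal H_B$ to the operators on a finite-dimensional Hilbert space $\mathcal H_C$; (IV) restricted to pure states $D_R^\Lambda$ is an entanglement monotone: it is nonnegative, it vanishes on product vectors, and its average over the outcomes of any finite LOCC protocol (successive local generalized measurements on $\mathcal H_A$ or on $\mathcal H_B$, each depending on the earlier outcomes) run on a pure state $\phi$ is at most $D_R^\Lambda(|\phi\rangle\langle\phi|)$.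 For every unit vector $\phi$ one has $0\le E_R^\Lambda(\phi)\le 1$ and $$D_R^\Lambda(|\phi\rangle\langle\phi|)=1-\sqrt{1-E_R^\Lambda(\phi)},$$ and $x\mapsto1-\sqrt{1-x}$ is strictly increasing on $[0,1]$. Finally, every maximally entangled vector $\phi=d_A^{-1/2}\sum_{i}e_i\otimes f_i$ (with $(e_i)$ an orthonormal basis of $\mathcal H_A$ and $(f_i)$ an orthonormal family in $\mathcal H_B$, so that $d_A\le d_B$) maximizes $D_R^\Lambda$ over all states. If $d_A\ge2$ and $\{\lambda_k\}$ is the harmonic spectrum $\{e^{2\pi ik/d_A}\}_{k=0}^{d_A-1}$, then $D_R^\Lambda(|\phi\rangle\langle\phi|)=1$ for each such $\phi$; hence, if moreover $d_A\le d_B$, the maximum of $D_R^\Lambda$ over all states is $1$. -/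

import Mathlib

open scoped Kronecker MatrixOrder ComplexOrder

noncomputable section

namespace BuresDiscord

variable {A B C n : Type*} [Fintype A] [DecidableEq A] [Fintype B] [DecidableEq B]
  [Fintype C] [DecidableEq C] [Fintype n] [DecidableEq n]

/-- A density matrix: positive semidefinite with unit trace. -/
def IsState (ρ : Matrix n n ℂ) : Prop :=
  ρ.PosSemidef ∧ ρ.trace = 1

/-- The operator `|φ⟩⟨φ|`. -/
def ketbra (φ : EuclideanSpace ℂ n) : Matrix n n ℂ :=
  Matrix.vecMulVec φ.ofLp (star φ.ofLp)

/-- The product vector `a ⊗ b`. -/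
def tensorVec (a : EuclideanSpace ℂ A) (b : EuclideanSpace ℂ B) : EuclideanSpace ℂ (A × B) :=
  WithLp.toLp 2 fun x => a x.1 * b x.2

/-- Classical-quantum states `∑ i, p i |e i⟩⟨e i| ⊗ σ i`, with `e` an orthonormal basis of the
first subsystem, `p` a probability vector and `σ i` states of the second subsystem. -/
def IsClassicalQuantum (ρ : Matrix (A × B) (A × B) ℂ) : Prop :=
  ∃ (e : OrthonormalBasis A ℂ (EuclideanSpace ℂ A)) (p : A → ℝ) (σ : A → Matrix B B ℂ),
    (∀ i, 0 ≤ p i) ∧ ∑ i, p i = 1 ∧ (∀ i, IsState (σ i)) ∧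
      ρ = ∑ i, (p i : ℂ) • (ketbra (e i) ⊗ₖ σ i)

/-- The square root of the Uhlmann fidelity, `Tr √(√ρ σ √ρ)`. -/
def rootFidelity (ρ σ : Matrix n n ℂ) : ℝ :=
  (CFC.sqrt (CFC.sqrt ρ * σ * CFC.sqrt ρ)).trace.re

/-- The Uhlmann fidelity. -/
def fidelity (ρ σ : Matrix n n ℂ) : ℝ :=
  rootFidelity ρ σ ^ 2

/-- The set `Λ` of unitary matrices with spectrum `{lam k}`. When `lam` is injective, the spectrum
has as many points as the dimension, so it is fully nondegenerate. -/
def unitariesWithSpectrum (lam : Fin (Fintype.card A) → ℂ) : Set (Matrix A A ℂ) :=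
  {U | U ∈ Matrix.unitaryGroup A ℂ ∧ spectrum ℂ U = Set.range lam}

/-- The harmonic spectrum: `d` equally spaced roots of unity. -/
def harmonicSpectrum (d : ℕ) (k : Fin d) : ℂ :=
  Complex.exp (2 * Real.pi * Complex.I * (k : ℕ) / d)

/-- The state `(U ⊗ 1) ρ (U ⊗ 1)†`. -/
def perturb (U : Matrix A A ℂ) (ρ : Matrix (A × B) (A × B) ℂ) : Matrix (A × B) (A × B) ℂ :=
  (U ⊗ₖ (1 : Matrix B B ℂ)) * ρ * (U ⊗ₖ (1 : Matrix B B ℂ)).conjTranspose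

/-- The Bures discord of response. -/
def discordOfResponse (lam : Fin (Fintype.card A) → ℂ) (ρ : Matrix (A × B) (A × B) ℂ) : ℝ :=
  1 - sSup ((fun U => rootFidelity ρ (perturb U ρ)) '' unitariesWithSpectrum lam)

/-- The entanglement of response of a pure state. -/
def entanglementOfResponse (lam : Fin (Fintype.card A) → ℂ) (φ : EuclideanSpace ℂ (A × B)) : ℝ :=
  1 - sSup ((fun U => fidelity (ketbra φ) (perturb U (ketbra φ))) '' unitariesWithSpectrum lam)

/-- The map `id ⊗ Φ`, with `Φ` acting on the second factor. -/
def ampliation {K : Type*} (Φ : Matrix B B ℂ →ₗ[ℂ] Matrix C C ℂ) (X : Matrix (K × B) (K × B) ℂ) :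
    Matrix (K × C) (K × C) ℂ :=
  Matrix.of fun x y => Φ (Matrix.of fun b b' => X (x.1, b) (y.1, b')) x.2 y.2

/-- Completely positive trace-preserving maps. -/
structure IsCPTP (Φ : Matrix B B ℂ →ₗ[ℂ] Matrix C C ℂ) : Prop where
  completelyPositive : ∀ (k : ℕ) (X : Matrix (Fin k × B) (Fin k × B) ℂ),
    X.PosSemidef → (ampliation Φ X).PosSemidef
  tracePreserving : ∀ X : Matrix B B ℂ, (Φ X).trace = X.trace

/-- Maximally entangled vectors `d_A^{-1/2} ∑ i, e i ⊗ f i`, where `e` is an orthonormal basis of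
the first subsystem and `f` an orthonormal family in the second (so that `d_A ≤ d_B`). -/
def IsMaximallyEntangled (φ : EuclideanSpace ℂ (A × B)) : Prop :=
  ∃ (e : OrthonormalBasis A ℂ (EuclideanSpace ℂ A)) (f : A → EuclideanSpace ℂ B),
    Orthonormal ℂ f ∧
      φ = ((1 / Real.sqrt (Fintype.card A) : ℝ) : ℂ) • ∑ i, tensorVec (e i) (f i)

/-- Finite LOCC protocols: in each round one of the parties performs a generalized measurement
(a complete family of measurement operators), and the continuation may depend on the outcome. -/
inductive LOCC (A B : Type*) [Fintype A] [DecidableEq A] [Fintype B] [DecidableEq B]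
  | done : LOCC A B
  | measureA (k : ℕ) (M : Fin k → Matrix A A ℂ)
      (complete : ∑ i, (M i).conjTranspose * M i = 1) (next : Fin k → LOCC A B) : LOCC A B
  | measureB (k : ℕ) (M : Fin k → Matrix B B ℂ)
      (complete : ∑ i, (M i).conjTranspose * M i = 1) (next : Fin k → LOCC A B) : LOCC A B

/-- The average, over the outcomes of an LOCC protocol run on the pure state `φ`, of the value of
`E` at the final pure state. An outcome with operator `K` has probability `‖K φ‖ ^ 2` and
leads to `K φ / ‖K φ‖`; outcomes of probability zero do not contribute. -/
def LOCC.average (E : EuclideanSpace ℂ (A × B) → ℝ) :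
    LOCC A B → EuclideanSpace ℂ (A × B) → ℝ
  | .done, φ => E φ
  | .measureA _ M _ next, φ => ∑ i,
      ‖Matrix.toEuclideanLin (M i ⊗ₖ (1 : Matrix B B ℂ)) φ‖ ^ 2 *
        (next i).average E
          ((‖Matrix.toEuclideanLin (M i ⊗ₖ (1 : Matrix B B ℂ)) φ‖⁻¹ : ℂ) •
            Matrix.toEuclideanLin (M i ⊗ₖ (1 : Matrix B B ℂ)) φ)
  | .measureB _ M _ next, φ => ∑ i,
      ‖Matrix.toEuclideanLin ((1 : Matrix A A ℂ) ⊗ₖ M i) φ‖ ^ 2 *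
        (next i).average E
          ((‖Matrix.toEuclideanLin ((1 : Matrix A A ℂ) ⊗ₖ M i) φ‖⁻¹ : ℂ) •
            Matrix.toEuclideanLin ((1 : Matrix A A ℂ) ⊗ₖ M i) φ)

/-- Entanglement monotones on pure bipartite states: nonnegative, zero on product states, and
not increasing on average under LOCC. -/
structure IsPureEntanglementMonotone (E : EuclideanSpace ℂ (A × B) → ℝ) : Prop where
  nonneg : ∀ φ, ‖φ‖ = 1 → 0 ≤ E φ
  product : ∀ (a : EuclideanSpace ℂ A) (b : EuclideanSpace ℂ B), ‖a‖ = 1 → ‖b‖ = 1 →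
    E (tensorVec a b) = 0
  average_le : ∀ (P : LOCC A B) (φ : EuclideanSpace ℂ (A × B)), ‖φ‖ = 1 → P.average E φ ≤ E φ

end BuresDiscord

end

open BuresDiscord

/-!
The proof rests on Uhlmann's theorem in the following form. For positive matrices `ρ`, `σ`, the root
fidelity `Tr √(√ρ σ √ρ)` is the largest value of `Re Tr (P Qᴴ)` over all factorizations `ρ = P Pᴴ`,
`σ = Q Qᴴ` (`trace_mul_le_rootFidelity`, `exists_unitary_trace_eq_rootFidelity`); equivalently it is
the largest `Re Tr X` such that the block matrix with diagonal blocks `ρ`, `σ` and off-diagonal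
block `X` is positive (`trace_le_rootFidelity_of_posSemidef`,
`exists_posSemidef_trace_eq_rootFidelity`). Both halves follow from polar decomposition.

* Factorizations turn the supremum defining the discord into the maximum of a continuous function
  on a compact set, so it is attained (`isGreatest_rootFidelity`). Expanding
  `0 ≤ Tr (P - Q) (P - Q)ᴴ` shows that the root fidelity of two states is at most `1`, with
  equality only if they coincide. Hence the discord vanishes if and only if `ρ` commutes with some
  `U ⊗ 1`, `U ∈ Λ`. As `U` has distinct eigenvalues, this says that `ρ` is block diagonal in an
  eigenbasis of `U`, that is, classical-quantum (`discordOfResponse_eq_zero_iff`).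
* Invariance under local unitaries is immediate. For a channel `Φ` on the second subsystem, applying
  `id ⊗ Φ` to the positive block matrix preserves its positivity and `Tr X`, so the root fidelity
  cannot decrease (`IsCPTP.rootFidelity_le_ampliation`).
* For a unit vector with reduced state `τ` on the first subsystem, the discord is
  `1 - max_U |Tr (U τ)|` (`discordOfResponse_ketbra`). The function `τ ↦ max_U |Tr (U τ)|` is
  subadditive, homogeneous and unitarily invariant. A measurement on the second subsystem decomposes
  `τ`; a measurement `M i` on the first one gives `M i τ (M i)ᴴ`, unitarily equivalent to
  `√τ (M i)ᴴ (M i) √τ`, and these operators again sum up to `τ`. So neither increases the average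
  discord, and induction over the rounds of the protocol proves monotonicity under LOCC.
* For every state and every `U`, the root fidelity is at least `|Tr ((U ⊗ 1) ρ)|`. Averaging over the
  cyclic shifts of a diagonal `U ∈ Λ`, which sum up to the scalar `∑ λ_k`, shows that the discord is
  at most `1 - |∑ λ_k| / d`. A maximally entangled vector has reduced state `1 / d` and attains this
  bound; for the harmonic spectrum `∑ λ_k = 0`.
-/

set_option linter.unusedSectionVars false

namespace BuresDiscord
open Matrix

/-! ### Polar decomposition -/

/-- Two linear maps with `‖T v‖ = ‖S v‖` for all `v` differ by a contraction on the left: it is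
defined on the range of `S` by `S v ↦ T v` and vanishes on the orthogonal complement. -/
lemma exists_contraction_comp_eq {E F G : Type*} [NormedAddCommGroup E] [InnerProductSpace ℂ E]
    [NormedAddCommGroup F] [InnerProductSpace ℂ F] [NormedAddCommGroup G] [InnerProductSpace ℂ G]
    [FiniteDimensional ℂ G] (T : E →ₗ[ℂ] F) (S : E →ₗ[ℂ] G) (h : ∀ v, ‖T v‖ = ‖S v‖) :
    ∃ K : G →ₗ[ℂ] F, (∀ v, K (S v) = T v) ∧ ∀ v, ‖K v‖ ≤ ‖v‖ := by
  obtain ⟨g, hg⟩ := S.rangeRestrict.exists_rightInverse_of_surjective S.range_rangeRestrict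
  have hg' : ∀ w : LinearMap.range S, S (g w) = w := fun w => by
    simpa using congrArg Subtype.val (LinearMap.congr_fun hg w)
  refine ⟨T ∘ₗ g ∘ₗ ((LinearMap.range S).orthogonalProjectionOnto : G →ₗ[ℂ] _), fun v => ?_,
    fun v => ?_⟩
  · have h1 : (LinearMap.range S).orthogonalProjectionOnto (S v) = ⟨S v, v, rfl⟩ :=
      Submodule.orthogonalProjectionOnto_mem_subspace_eq_self (K := LinearMap.range S) ⟨S v, v, rfl⟩
    have h2 : ‖T (g ⟨S v, v, rfl⟩ - v)‖ = 0 := by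
      rw [h, map_sub, hg']; simp
    rw [norm_eq_zero, map_sub, sub_eq_zero] at h2
    simpa [h1] using h2
  · simp only [LinearMap.comp_apply, h, hg']
    exact (LinearMap.range S).norm_orthogonalProjectionOnto_apply_le v

/-- In the square case the contraction may be replaced by an isometry. -/
lemma exists_isometry_comp_eq {E : Type*} [NormedAddCommGroup E] [InnerProductSpace ℂ E]
    [FiniteDimensional ℂ E] (T S : E →ₗ[ℂ] E) (h : ∀ v, ‖T v‖ = ‖S v‖) :
    ∃ K : E →ₗᵢ[ℂ] E, ∀ v, K (S v) = T v := by
  obtain ⟨K, hK, -⟩ := exists_contraction_comp_eq T S h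
  let L : LinearMap.range S →ₗᵢ[ℂ] E :=
    { toLinearMap := K ∘ₗ (LinearMap.range S).subtype
      norm_map' := by
        rintro ⟨_, v, rfl⟩
        simp [hK, h] }
  refine ⟨L.extend, fun v => ?_⟩
  have := L.extend_apply ⟨S v, v, rfl⟩
  rw [this]
  exact hK v

section
variable {m n k : Type*} [Fintype m] [DecidableEq m] [Fintype n] [DecidableEq n]
  [Fintype k] [DecidableEq k]

lemma inner_toEuclideanLin (T : Matrix m n ℂ) (S : Matrix m n ℂ) (v w : EuclideanSpace ℂ n) :
    inner ℂ (toEuclideanLin T v) (toEuclideanLin S w)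
      = inner ℂ v (toEuclideanLin (Tᴴ * S) w) := by
  rw [toLpLin_mul_same, LinearMap.comp_apply, toEuclideanLin_conjTranspose_eq_adjoint,
    LinearMap.adjoint_inner_right]

lemma norm_toEuclideanLin_eq {T : Matrix m n ℂ} {S : Matrix k n ℂ} (h : Tᴴ * T = Sᴴ * S)
    (v : EuclideanSpace ℂ n) : ‖toEuclideanLin T v‖ = ‖toEuclideanLin S v‖ := by
  rw [@norm_eq_sqrt_re_inner ℂ, @norm_eq_sqrt_re_inner ℂ, inner_toEuclideanLin,
    inner_toEuclideanLin, h]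

lemma posSemidef_one_sub_of_norm_le {K : Matrix m n ℂ}
    (h : ∀ v, ‖toEuclideanLin K v‖ ≤ ‖v‖) : (1 - Kᴴ * K).PosSemidef := by
  rw [← isPositive_toEuclideanLin_iff]
  refine ⟨?_, fun v => ?_⟩
  · rw [isSymmetric_toEuclideanLin_iff]
    simp [IsHermitian]
  · rw [← inner_conj_symm, RCLike.conj_re, map_sub, LinearMap.sub_apply, inner_sub_right,
      ← inner_toEuclideanLin, map_sub, toLpLin_one, LinearMap.id_apply,
      inner_self_eq_norm_sq, inner_self_eq_norm_sq]
    have := h v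
    have h0 := norm_nonneg (toEuclideanLin K v)
    nlinarith

lemma exists_contraction_mul_eq {T : Matrix m n ℂ} {S : Matrix k n ℂ} (h : Tᴴ * T = Sᴴ * S) :
    ∃ K : Matrix m k ℂ, T = K * S ∧ (1 - Kᴴ * K).PosSemidef := by
  obtain ⟨K, hK, hn⟩ := exists_contraction_comp_eq (toEuclideanLin T) (toEuclideanLin S)
    (norm_toEuclideanLin_eq h)
  refine ⟨toEuclideanLin.symm K, ?_, posSemidef_one_sub_of_norm_le (by simpa using hn)⟩
  apply toEuclideanLin.injective
  rw [toLpLin_mul_same, LinearEquiv.apply_symm_apply]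
  ext1 v
  exact (hK v).symm

/-- Polar decomposition of square matrices, in the form of a uniqueness statement: matrices with
the same `TᴴT` differ by a unitary on the left. -/
lemma exists_unitary_mul_eq {T S : Matrix n n ℂ} (h : Tᴴ * T = Sᴴ * S) :
    ∃ W ∈ unitaryGroup n ℂ, T = W * S := by
  obtain ⟨K, hK⟩ := exists_isometry_comp_eq (toEuclideanLin T) (toEuclideanLin S)
    (norm_toEuclideanLin_eq h)
  refine ⟨toEuclideanLin.symm K.toLinearMap, ?_, ?_⟩
  · rw [mem_unitaryGroup_iff', star_eq_conjTranspose]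
    apply toEuclideanLin.injective
    rw [toLpLin_one]
    ext1 v
    refine ext_inner_left ℂ fun w => ?_
    rw [← inner_toEuclideanLin, LinearEquiv.apply_symm_apply]
    exact K.inner_map_map w v
  · apply toEuclideanLin.injective
    rw [toLpLin_mul_same, LinearEquiv.apply_symm_apply]
    ext1 v
    exact (hK v).symm

/-! ### Uhlmann's theorem -/

lemma trace_re_nonneg {P : Matrix n n ℂ} (h : P.PosSemidef) : 0 ≤ P.trace.re :=
  (Complex.nonneg_iff.1 h.trace_nonneg).1

lemma trace_mul_re_nonneg {P Q : Matrix n n ℂ} (hP : P.PosSemidef) (hQ : Q.PosSemidef) :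
    0 ≤ (P * Q).trace.re := by
  obtain ⟨S, rfl⟩ := CStarAlgebra.nonneg_iff_eq_star_mul_self.1 (nonneg_iff_posSemidef.2 hQ)
  rw [star_eq_conjTranspose, ← Matrix.mul_assoc, trace_mul_comm, ← Matrix.mul_assoc]
  exact trace_re_nonneg (hP.mul_mul_conjTranspose_same S)

lemma trace_conjTranspose_re (P : Matrix n n ℂ) : (Pᴴ).trace.re = P.trace.re := by
  simp [trace_conjTranspose]

/-- The trace of a positive matrix does not increase, in real part, when multiplied by a product
of two contractions: expand `0 ≤ Tr (K₁ - K₂) R (K₁ - K₂)ᴴ`. -/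
lemma trace_contraction_mul_le {K L : Matrix m n ℂ} {R : Matrix n n ℂ}
    (hK : (1 - Kᴴ * K).PosSemidef) (hL : (1 - Lᴴ * L).PosSemidef) (hR : R.PosSemidef) :
    (Kᴴ * L * R).trace.re ≤ R.trace.re := by
  have h1 := trace_re_nonneg (hR.mul_mul_conjTranspose_same (K - L))
  have h2 := trace_mul_re_nonneg hK hR
  have h3 := trace_mul_re_nonneg hL hR
  have e1 : (K - L) * R * (K - L)ᴴ = K * R * Kᴴ - K * R * Lᴴ - L * R * Kᴴ + L * R * Lᴴ := by
    rw [conjTranspose_sub, Matrix.sub_mul, Matrix.sub_mul, Matrix.mul_sub, Matrix.mul_sub]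
    abel
  have c1 : (K * R * Kᴴ).trace = (Kᴴ * K * R).trace := by
    rw [trace_mul_comm, ← Matrix.mul_assoc]
  have c2 : (L * R * Lᴴ).trace = (Lᴴ * L * R).trace := by
    rw [trace_mul_comm, ← Matrix.mul_assoc]
  have c3 : (L * R * Kᴴ).trace = (Kᴴ * L * R).trace := by
    rw [trace_mul_comm, ← Matrix.mul_assoc]
  have c4 : (K * R * Lᴴ).trace.re = (Kᴴ * L * R).trace.re := by
    rw [← c3, ← trace_conjTranspose_re, conjTranspose_mul, conjTranspose_mul,
      conjTranspose_conjTranspose, hR.isHermitian.eq, ← Matrix.mul_assoc]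
  rw [e1] at h1
  simp only [Matrix.sub_mul, Matrix.one_mul, trace_sub, trace_add, Complex.sub_re,
    Complex.add_re, c1, c2, c3, c4] at h1 h2 h3
  linarith

lemma posSemidef_sqrt (ρ : Matrix n n ℂ) : (CFC.sqrt ρ).PosSemidef :=
  nonneg_iff_posSemidef.1 (CFC.sqrt_nonneg ρ)

lemma conjTranspose_sqrt (ρ : Matrix n n ℂ) : (CFC.sqrt ρ)ᴴ = CFC.sqrt ρ :=
  (posSemidef_sqrt ρ).isHermitian.eq

lemma sqrt_mul_sqrt {ρ : Matrix n n ℂ} (h : ρ.PosSemidef) : CFC.sqrt ρ * CFC.sqrt ρ = ρ :=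
  CFC.sqrt_mul_sqrt_self ρ (nonneg_iff_posSemidef.2 h)

/-- The easy half of Uhlmann's theorem: any two factorizations `ρ = P Pᴴ`, `σ = Q Qᴴ` through a
common space bound the root fidelity from below. -/
lemma trace_mul_le_rootFidelity {ρ σ : Matrix n n ℂ} {P Q : Matrix n m ℂ} (hP : P * Pᴴ = ρ)
    (hQ : Q * Qᴴ = σ) : (P * Qᴴ).trace.re ≤ rootFidelity ρ σ := by
  have hρ : ρ.PosSemidef := hP ▸ posSemidef_self_mul_conjTranspose P
  set s := CFC.sqrt ρ with hs
  have hsH : sᴴ = s := conjTranspose_sqrt ρ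
  -- `Pᴴ = V √ρ` and `Qᴴ √ρ = K R`, with `R = √(√ρ σ √ρ)`, give `Tr (P Qᴴ) = Tr (Vᴴ K R)`.
  obtain ⟨V, hV, hVc⟩ := exists_contraction_mul_eq (T := Pᴴ) (S := s)
    (by rw [conjTranspose_conjTranspose, hP, hsH, sqrt_mul_sqrt hρ])
  have hpos : (s * σ * s).PosSemidef := by
    have : (s * σ * s) = (Qᴴ * s)ᴴ * (Qᴴ * s) := by
      rw [conjTranspose_mul, conjTranspose_conjTranspose, hsH, ← hQ]; simp only [Matrix.mul_assoc]
    rw [this]; exact posSemidef_conjTranspose_mul_self _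
  obtain ⟨K, hK, hKc⟩ := exists_contraction_mul_eq (T := Qᴴ * s) (S := CFC.sqrt (s * σ * s))
    (by rw [conjTranspose_sqrt, sqrt_mul_sqrt hpos, conjTranspose_mul,
          conjTranspose_conjTranspose, hsH, ← hQ]; simp only [Matrix.mul_assoc])
  have hP' : P = s * Vᴴ := by
    rw [← conjTranspose_conjTranspose P, hV, conjTranspose_mul, hsH]
  have : (P * Qᴴ).trace = (Vᴴ * K * CFC.sqrt (s * σ * s)).trace := by
    rw [Matrix.mul_assoc Vᴴ, ← hK, hP', Matrix.mul_assoc, trace_mul_comm, Matrix.mul_assoc]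
  rw [this]
  exact trace_contraction_mul_le hVc hKc (posSemidef_sqrt _)

/-- The other half of Uhlmann's theorem: for a square factor `S` of `σ` the root fidelity is
attained by a suitable unitary between the factors of `ρ` and `σ`. -/
lemma exists_unitary_trace_eq_rootFidelity {ρ σ S : Matrix n n ℂ} (hS : S * Sᴴ = σ) :
    ∃ W ∈ unitaryGroup n ℂ, (CFC.sqrt ρ * W * Sᴴ).trace.re = rootFidelity ρ σ := by
  set s := CFC.sqrt ρ with hs
  have hsH : sᴴ = s := conjTranspose_sqrt ρ
  have e : s * σ * s = (Sᴴ * s)ᴴ * (Sᴴ * s) := by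
    rw [conjTranspose_mul, conjTranspose_conjTranspose, hsH, ← hS]; simp only [Matrix.mul_assoc]
  have hpos : (s * σ * s).PosSemidef := e ▸ posSemidef_conjTranspose_mul_self _
  obtain ⟨W, hW, h⟩ := exists_unitary_mul_eq (T := CFC.sqrt (s * σ * s)) (S := Sᴴ * s)
    (by rw [conjTranspose_sqrt, sqrt_mul_sqrt hpos, e])
  refine ⟨W, hW, ?_⟩
  rw [rootFidelity, ← hs, h, Matrix.mul_assoc, trace_mul_comm, Matrix.mul_assoc]

lemma conjTranspose_mul_self_of_mem {W : Matrix n n ℂ} (hW : W ∈ unitaryGroup n ℂ) :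
    Wᴴ * W = 1 := mem_unitaryGroup_iff'.1 hW

lemma mul_conjTranspose_self_of_mem {W : Matrix n n ℂ} (hW : W ∈ unitaryGroup n ℂ) :
    W * Wᴴ = 1 := mem_unitaryGroup_iff.1 hW

lemma sqrt_mul_unitary_factor {ρ W : Matrix n n ℂ} (hρ : ρ.PosSemidef)
    (hW : W ∈ unitaryGroup n ℂ) : (CFC.sqrt ρ * W) * (CFC.sqrt ρ * W)ᴴ = ρ := by
  rw [conjTranspose_mul, conjTranspose_sqrt, Matrix.mul_assoc, ← Matrix.mul_assoc W,
    mul_conjTranspose_self_of_mem hW, Matrix.one_mul, sqrt_mul_sqrt hρ]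

lemma exists_factors_trace_eq_rootFidelity {ρ σ : Matrix n n ℂ} (hρ : ρ.PosSemidef)
    (hσ : σ.PosSemidef) : ∃ P Q : Matrix n n ℂ, P * Pᴴ = ρ ∧ Q * Qᴴ = σ ∧
      (P * Qᴴ).trace.re = rootFidelity ρ σ := by
  obtain ⟨W, hW, h⟩ := exists_unitary_trace_eq_rootFidelity (ρ := ρ) (σ := σ) (S := CFC.sqrt σ)
    (by rw [conjTranspose_sqrt, sqrt_mul_sqrt hσ])
  exact ⟨_, _, sqrt_mul_unitary_factor hρ hW, by rw [conjTranspose_sqrt, sqrt_mul_sqrt hσ], h⟩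

lemma rootFidelity_nonneg (ρ σ : Matrix n n ℂ) : 0 ≤ rootFidelity ρ σ :=
  trace_re_nonneg (posSemidef_sqrt _)

lemma trace_sub_mul_sub_re (P Q : Matrix n m ℂ) :
    ((P - Q) * (P - Q)ᴴ).trace.re
      = (P * Pᴴ).trace.re + (Q * Qᴴ).trace.re - 2 * (P * Qᴴ).trace.re := by
  have h : (Q * Pᴴ).trace.re = (P * Qᴴ).trace.re := by
    rw [← trace_conjTranspose_re, conjTranspose_mul, conjTranspose_conjTranspose]
  rw [conjTranspose_sub, Matrix.sub_mul, Matrix.mul_sub, Matrix.mul_sub]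
  simp only [trace_sub, Complex.sub_re, h]
  ring

lemma rootFidelity_le_one {ρ σ : Matrix n n ℂ} (hρ : IsState ρ) (hσ : IsState σ) :
    rootFidelity ρ σ ≤ 1 := by
  obtain ⟨P, Q, hP, hQ, h⟩ := exists_factors_trace_eq_rootFidelity hρ.1 hσ.1
  have h1 := trace_re_nonneg (posSemidef_self_mul_conjTranspose (P - Q))
  rw [trace_sub_mul_sub_re, hP, hQ, hρ.2, hσ.2, h, Complex.one_re] at h1
  linarith

lemma eq_of_rootFidelity_eq_one {ρ σ : Matrix n n ℂ} (hρ : IsState ρ) (hσ : IsState σ)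
    (h1 : rootFidelity ρ σ = 1) : ρ = σ := by
  obtain ⟨P, Q, hP, hQ, h⟩ := exists_factors_trace_eq_rootFidelity hρ.1 hσ.1
  have hps := posSemidef_self_mul_conjTranspose (P - Q)
  have h2 := trace_sub_mul_sub_re P Q
  rw [hP, hQ, hρ.2, hσ.2, h, h1, Complex.one_re] at h2
  -- Equality forces the two optimal factors to coincide.
  have h3 : ((P - Q) * (P - Q)ᴴ).trace = 0 :=
    Complex.ext (by rw [h2]; norm_num) (Complex.nonneg_iff.1 hps.trace_nonneg).2.symm
  rw [trace_mul_conjTranspose_self_eq_zero_iff, sub_eq_zero] at h3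
  rw [← hP, ← hQ, h3]

lemma rootFidelity_self {ρ : Matrix n n ℂ} (hρ : IsState ρ) : rootFidelity ρ ρ = 1 := by
  refine le_antisymm (rootFidelity_le_one hρ hρ) ?_
  have h : CFC.sqrt ρ * (CFC.sqrt ρ)ᴴ = ρ := by rw [conjTranspose_sqrt, sqrt_mul_sqrt hρ.1]
  have := trace_mul_le_rootFidelity h h
  rwa [h, hρ.2, Complex.one_re] at this

/-- The block form of the lower bound: `Re Tr X ≤ Tr √(√ρ σ √ρ)` whenever `ρ` and `σ` are the
diagonal blocks and `X` the off-diagonal block of a positive matrix. -/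
lemma trace_le_rootFidelity_of_posSemidef {ρ σ X : Matrix n n ℂ}
    (h : (fromBlocks ρ X Xᴴ σ).PosSemidef) : X.trace.re ≤ rootFidelity ρ σ := by
  -- The upper and lower halves of the square root of the block matrix factor `ρ` and `σ`.
  set s := CFC.sqrt (fromBlocks ρ X Xᴴ σ) with hs
  have hss : s * sᴴ = fromBlocks ρ X Xᴴ σ := by rw [conjTranspose_sqrt, sqrt_mul_sqrt h]
  have key : ∀ (f g : n → n ⊕ n), (s.submatrix f id) * (s.submatrix g id)ᴴ
      = (fromBlocks ρ X Xᴴ σ).submatrix f g := fun f g => by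
    rw [← hss, submatrix_mul _ _ f id g Function.bijective_id, conjTranspose_submatrix]
  have h1 := key Sum.inl Sum.inl
  have h2 := key Sum.inl Sum.inr
  have h3 := key Sum.inr Sum.inr
  have := trace_mul_le_rootFidelity h1 h3
  rw [h2] at this
  exact this

lemma exists_posSemidef_trace_eq_rootFidelity {ρ σ : Matrix n n ℂ} (hρ : ρ.PosSemidef)
    (hσ : σ.PosSemidef) : ∃ X : Matrix n n ℂ, (fromBlocks ρ X Xᴴ σ).PosSemidef ∧
      X.trace.re = rootFidelity ρ σ := by
  obtain ⟨P, Q, hP, hQ, h⟩ := exists_factors_trace_eq_rootFidelity hρ hσ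
  refine ⟨P * Qᴴ, ?_, h⟩
  have : fromBlocks ρ (P * Qᴴ) (P * Qᴴ)ᴴ σ = fromRows P Q * (fromRows P Q)ᴴ := by
    rw [conjTranspose_fromRows_eq_fromCols_conjTranspose, fromRows_mul_fromCols, hP, hQ,
      conjTranspose_mul, conjTranspose_conjTranspose]
  rw [this]
  exact posSemidef_self_mul_conjTranspose _
end

section
variable {A B C n : Type*} [Fintype A] [DecidableEq A] [Fintype B] [DecidableEq B]
  [Fintype C] [DecidableEq C] [Fintype n] [DecidableEq n]

/-! ### Unitaries with prescribed spectrum -/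

lemma isCompact_unitaryGroup : IsCompact (unitaryGroup n ℂ : Set (Matrix n n ℂ)) := by
  have hcl : IsClosed (unitaryGroup n ℂ : Set (Matrix n n ℂ)) := by
    have : (unitaryGroup n ℂ : Set (Matrix n n ℂ)) = {U | U * Uᴴ = 1} := by
      ext U; exact mem_unitaryGroup_iff
    rw [this]
    exact isClosed_eq (by fun_prop) continuous_const
  have hc : IsCompact (Set.univ.pi fun _ : n => Set.univ.pi fun _ : n =>
      Metric.closedBall (0 : ℂ) 1) :=
    isCompact_univ_pi fun _ => isCompact_univ_pi fun _ => isCompact_closedBall _ _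
  refine hc.of_isClosed_subset hcl fun U hU i _ j _ => ?_
  rw [mem_closedBall_zero_iff]
  exact entry_norm_bound_of_unitary hU i j

/-- The matrix whose columns are the given vectors. -/
def colMatrix (v : n → EuclideanSpace ℂ n) : Matrix n n ℂ := Matrix.of fun i a => v a i

lemma colMatrix_conjTranspose_mul (v w : n → EuclideanSpace ℂ n) (a b : n) :
    ((colMatrix v)ᴴ * colMatrix w) a b = inner ℂ (v a) (w b) := by
  simp [colMatrix, mul_apply, PiLp.inner_apply, mul_comm]

lemma colMatrix_mem_unitaryGroup_iff {v : n → EuclideanSpace ℂ n} :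
    colMatrix v ∈ unitaryGroup n ℂ ↔ Orthonormal ℂ v := by
  rw [mem_unitaryGroup_iff', star_eq_conjTranspose, orthonormal_iff_ite, ← ext_iff]
  simp only [colMatrix_conjTranspose_mul, one_apply]

lemma exists_orthonormalBasis_eq {v : n → EuclideanSpace ℂ n} (hv : Orthonormal ℂ v) :
    ∃ e : OrthonormalBasis n ℂ (EuclideanSpace ℂ n), ⇑e = v := by
  obtain ⟨e, he⟩ := Orthonormal.exists_orthonormalBasis_extension_of_card_eq (𝕜 := ℂ)
    (E := EuclideanSpace ℂ n) (ι := n) (by simp) (v := v) (s := Set.univ)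
    (hv.comp _ Subtype.val_injective)
  exact ⟨e, funext fun i => he i trivial⟩

lemma exists_orthonormalBasis_colMatrix_eq {V : Matrix n n ℂ} (hV : V ∈ unitaryGroup n ℂ) :
    ∃ e : OrthonormalBasis n ℂ (EuclideanSpace ℂ n), colMatrix e = V := by
  have h : colMatrix (fun a => WithLp.toLp 2 fun i => V i a) = V := rfl
  obtain ⟨e, he⟩ := exists_orthonormalBasis_eq (colMatrix_mem_unitaryGroup_iff.1 (h.symm ▸ hV))
  exact ⟨e, by rw [he, h]⟩

/-- The diagonal matrix with the prescribed eigenvalues, in an arbitrary enumeration of `A`. -/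
noncomputable def spectrumMatrix (lam : Fin (Fintype.card A) → ℂ) : Matrix A A ℂ :=
  diagonal fun a => lam (Fintype.equivFin A a)

lemma mul_mem_unitaryGroup {U V : Matrix n n ℂ} (hU : U ∈ unitaryGroup n ℂ)
    (hV : V ∈ unitaryGroup n ℂ) : U * V ∈ unitaryGroup n ℂ := mul_mem hU hV

lemma conjTranspose_mem_unitaryGroup {U : Matrix n n ℂ} (hU : U ∈ unitaryGroup n ℂ) :
    Uᴴ ∈ unitaryGroup n ℂ := Unitary.star_mem hU

lemma conj_mem_unitariesWithSpectrum {lam : Fin (Fintype.card A) → ℂ} {U V : Matrix A A ℂ}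
    (hU : U ∈ unitariesWithSpectrum lam) (hV : V ∈ unitaryGroup A ℂ) :
    V * U * Vᴴ ∈ unitariesWithSpectrum lam := by
  refine ⟨mul_mem_unitaryGroup (mul_mem_unitaryGroup hV hU.1)
    (conjTranspose_mem_unitaryGroup hV), ?_⟩
  rw [← hU.2]
  exact Unitary.spectrum_star_right_conjugate (R := ℂ) (a := U) (U := ⟨V, hV⟩)

lemma spectrumMatrix_mem {lam : Fin (Fintype.card A) → ℂ} (hunit : ∀ k, ‖lam k‖ = 1) :
    spectrumMatrix (A := A) lam ∈ unitariesWithSpectrum lam := by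
  refine ⟨?_, ?_⟩
  · rw [mem_unitaryGroup_iff, star_eq_conjTranspose, spectrumMatrix, diagonal_conjTranspose,
      diagonal_mul_diagonal, ← diagonal_one]
    congr 1
    ext a
    simp [Complex.mul_conj, Complex.normSq_eq_norm_sq, hunit]
  · rw [spectrumMatrix, spectrum_diagonal]
    exact (Fintype.equivFin A).surjective.range_comp lam

/-- A unitary with the nondegenerate spectrum `{lam k}` is diagonal in an orthonormal basis:
eigenvectors of a unitary for distinct eigenvalues are orthogonal. -/
lemma mem_unitariesWithSpectrum_iff {lam : Fin (Fintype.card A) → ℂ}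
    (hlam : Function.Injective lam) (hunit : ∀ k, ‖lam k‖ = 1) {U : Matrix A A ℂ} :
    U ∈ unitariesWithSpectrum lam ↔
      ∃ V ∈ unitaryGroup A ℂ, U = V * spectrumMatrix lam * Vᴴ := by
  constructor
  · rintro ⟨hU, hs⟩
    have hev : ∀ a : A, ∃ v : EuclideanSpace ℂ A, ‖v‖ = 1 ∧
        toEuclideanLin U v = lam (Fintype.equivFin A a) • v := fun a => by
      have : lam (Fintype.equivFin A a) ∈ spectrum ℂ (toEuclideanLin U) := by
        rw [spectrum_toLpLin, hs]; exact ⟨_, rfl⟩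
      obtain ⟨v, hv⟩ := (Module.End.hasEigenvalue_iff_mem_spectrum.2 this).exists_hasEigenvector
      have hv0 : ‖v‖ ≠ 0 := norm_ne_zero_iff.2 hv.2
      refine ⟨((‖v‖⁻¹ : ℝ) : ℂ) • v, ?_, ?_⟩
      · simp [norm_smul, hv0]
      · rw [map_smul, hv.apply_eq_smul, smul_comm]
    choose v hv1 hv using hev
    -- `⟪v a, v b⟫ = ⟪U v a, U v b⟫ = conj (λ a) λ b ⟪v a, v b⟫`, and `conj (λ a) λ b ≠ 1`.
    have hon : Orthonormal ℂ v := by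
      refine ⟨hv1, fun a b hab => ?_⟩
      have h1 := inner_toEuclideanLin U U (v a) (v b)
      rw [conjTranspose_mul_self_of_mem hU, toLpLin_one, LinearMap.id_apply, hv, hv,
        inner_smul_left, inner_smul_right, ← mul_assoc] at h1
      by_contra h0
      have h2 : (starRingEnd ℂ) (lam (Fintype.equivFin A a)) * lam (Fintype.equivFin A b) = 1 :=
        mul_right_cancel₀ h0 (by rw [h1, one_mul])
      have h3 : lam (Fintype.equivFin A a) * (starRingEnd ℂ) (lam (Fintype.equivFin A a)) = 1 := by
        simp [Complex.mul_conj, Complex.normSq_eq_norm_sq, hunit]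
      apply hab
      apply (Fintype.equivFin A).injective
      apply hlam
      rw [← mul_one (lam (Fintype.equivFin A a)), ← h2, ← mul_assoc, h3, one_mul]
    have hV := colMatrix_mem_unitaryGroup_iff.2 hon
    refine ⟨colMatrix v, hV, ?_⟩
    have hUV : U * colMatrix v = colMatrix v * spectrumMatrix lam := by
      ext i a
      have := congrArg (fun w : EuclideanSpace ℂ A => w i) (hv a)
      simp only [ofLp_toLpLin, toLin'_apply, PiLp.smul_apply, smul_eq_mul] at this
      rw [spectrumMatrix, mul_diagonal, mul_comm]
      exact this
    rw [← hUV, mul_assoc, mul_conjTranspose_self_of_mem hV, mul_one]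
  · rintro ⟨V, hV, rfl⟩
    exact conj_mem_unitariesWithSpectrum (spectrumMatrix_mem hunit) hV

lemma isCompact_unitariesWithSpectrum {lam : Fin (Fintype.card A) → ℂ}
    (hlam : Function.Injective lam) (hunit : ∀ k, ‖lam k‖ = 1) :
    IsCompact (unitariesWithSpectrum (A := A) lam) := by
  have : unitariesWithSpectrum (A := A) lam =
      (fun V => V * spectrumMatrix lam * Vᴴ) '' (unitaryGroup A ℂ : Set (Matrix A A ℂ)) := by
    ext U
    rw [mem_unitariesWithSpectrum_iff hlam hunit]
    simp only [Set.mem_image, SetLike.mem_coe, eq_comm]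
  rw [this]
  exact isCompact_unitaryGroup.image (by fun_prop)

/-! ### Existence of the maximum and local unitary invariance -/

lemma kronecker_one_mem {U : Matrix A A ℂ} (hU : U ∈ unitaryGroup A ℂ) :
    (U ⊗ₖ (1 : Matrix B B ℂ)) ∈ unitaryGroup (A × B) ℂ :=
  kronecker_mem_unitary hU (one_mem _)

lemma IsState.conj {ρ W : Matrix n n ℂ} (hρ : IsState ρ) (hW : W ∈ unitaryGroup n ℂ) :
    IsState (W * ρ * Wᴴ) :=
  ⟨hρ.1.mul_mul_conjTranspose_same W, by
    rw [trace_mul_comm, ← mul_assoc, conjTranspose_mul_self_of_mem hW, one_mul, hρ.2]⟩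

lemma IsState.perturb {ρ : Matrix (A × B) (A × B) ℂ} (hρ : IsState ρ) {U : Matrix A A ℂ}
    (hU : U ∈ unitaryGroup A ℂ) : IsState (perturb U ρ) :=
  hρ.conj (kronecker_one_mem hU)

/-- The maximum over `Λ` exists: by Uhlmann's theorem it is the maximum of a continuous function
over the product of `Λ` and the unitary group, which is compact. -/
lemma isGreatest_rootFidelity {lam : Fin (Fintype.card A) → ℂ}
    (hlam : Function.Injective lam) (hunit : ∀ k, ‖lam k‖ = 1) {ρ : Matrix (A × B) (A × B) ℂ}
    (hρ : ρ.PosSemidef) :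
    IsGreatest ((fun U => rootFidelity ρ (perturb U ρ)) '' unitariesWithSpectrum lam)
      (1 - discordOfResponse lam ρ) := by
  set s := CFC.sqrt ρ with hs
  have hfac : ∀ U : Matrix A A ℂ,
      ((U ⊗ₖ (1 : Matrix B B ℂ)) * s) * ((U ⊗ₖ (1 : Matrix B B ℂ)) * s)ᴴ = perturb U ρ := by
    intro U
    rw [conjTranspose_mul, conjTranspose_sqrt, BuresDiscord.perturb, mul_assoc, ← mul_assoc s,
      sqrt_mul_sqrt hρ, ← mul_assoc]
  let G : Matrix A A ℂ × Matrix (A × B) (A × B) ℂ → ℝ := fun x =>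
    (s * x.2 * ((x.1 ⊗ₖ (1 : Matrix B B ℂ)) * s)ᴴ).trace.re
  have hk : Continuous fun U : Matrix A A ℂ => U ⊗ₖ (1 : Matrix B B ℂ) := by
    refine continuous_matrix fun i j => ?_
    simp only [kroneckerMap_apply]
    fun_prop
  have hG : Continuous G := by
    refine Complex.continuous_re.comp (Continuous.matrix_trace ?_)
    have := hk.comp (continuous_fst (X := Matrix A A ℂ) (Y := Matrix (A × B) (A × B) ℂ))
    simp only [Function.comp_def] at this
    fun_prop
  obtain ⟨⟨U₀, W₀⟩, ⟨hU₀, hW₀⟩, hmax⟩ :=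
    ((isCompact_unitariesWithSpectrum hlam hunit).prod
      (isCompact_unitaryGroup (n := A × B))).exists_isMaxOn
      ⟨(spectrumMatrix lam, 1), spectrumMatrix_mem hunit, one_mem _⟩ hG.continuousOn
  have hgr : IsGreatest ((fun U => rootFidelity ρ (BuresDiscord.perturb U ρ)) ''
      unitariesWithSpectrum lam) (rootFidelity ρ (BuresDiscord.perturb U₀ ρ)) := by
    refine ⟨⟨U₀, hU₀, rfl⟩, ?_⟩
    rintro _ ⟨U, hU, rfl⟩
    obtain ⟨W, hW, h⟩ := exists_unitary_trace_eq_rootFidelity (ρ := ρ) (hfac U)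
    have h1 : G (U, W) ≤ G (U₀, W₀) := hmax (Set.mk_mem_prod hU hW)
    have h2 : G (U₀, W₀) ≤ rootFidelity ρ (BuresDiscord.perturb U₀ ρ) :=
      trace_mul_le_rootFidelity (sqrt_mul_unitary_factor hρ hW₀) (hfac U₀)
    simp only
    rw [← h]
    exact h1.trans h2
  rw [discordOfResponse, hgr.csSup_eq, sub_sub_cancel]
  exact hgr

lemma rootFidelity_le_one_sub_discord {lam : Fin (Fintype.card A) → ℂ}
    (hlam : Function.Injective lam) (hunit : ∀ k, ‖lam k‖ = 1) {ρ : Matrix (A × B) (A × B) ℂ}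
    (hρ : ρ.PosSemidef) {U : Matrix A A ℂ} (hU : U ∈ unitariesWithSpectrum lam) :
    rootFidelity ρ (perturb U ρ) ≤ 1 - discordOfResponse lam ρ :=
  (isGreatest_rootFidelity hlam hunit hρ).2 ⟨U, hU, rfl⟩

lemma discordOfResponse_nonneg {lam : Fin (Fintype.card A) → ℂ}
    (hlam : Function.Injective lam) (hunit : ∀ k, ‖lam k‖ = 1) {ρ : Matrix (A × B) (A × B) ℂ}
    (hρ : IsState ρ) : 0 ≤ discordOfResponse lam ρ := by
  obtain ⟨U, hU, h⟩ := (isGreatest_rootFidelity hlam hunit hρ.1).1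
  have := rootFidelity_le_one hρ (hρ.perturb hU.1)
  simp only at h
  linarith

lemma discordOfResponse_le_one {lam : Fin (Fintype.card A) → ℂ}
    (hlam : Function.Injective lam) (hunit : ∀ k, ‖lam k‖ = 1) {ρ : Matrix (A × B) (A × B) ℂ}
    (hρ : IsState ρ) : discordOfResponse lam ρ ≤ 1 := by
  obtain ⟨U, hU, h⟩ := (isGreatest_rootFidelity hlam hunit hρ.1).1
  have := rootFidelity_nonneg ρ (perturb U ρ)
  simp only at h
  linarith

/-- To bound the discord of one state by that of another it suffices to compare the root
fidelities, up to a change of the unitary within `Λ`. -/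
lemma discordOfResponse_le_of_forall {lam : Fin (Fintype.card A) → ℂ}
    (hlam : Function.Injective lam) (hunit : ∀ k, ‖lam k‖ = 1) {ρ : Matrix (A × B) (A × B) ℂ}
    {ρ' : Matrix (A × C) (A × C) ℂ} (hρ : ρ.PosSemidef) (hρ' : ρ'.PosSemidef)
    (h : ∀ U ∈ unitariesWithSpectrum lam, ∃ U' ∈ unitariesWithSpectrum lam,
      rootFidelity ρ (perturb U ρ) ≤ rootFidelity ρ' (perturb U' ρ')) :
    discordOfResponse lam ρ' ≤ discordOfResponse lam ρ := by
  obtain ⟨U, hU, h1⟩ := (isGreatest_rootFidelity hlam hunit hρ).1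
  obtain ⟨U', hU', h2⟩ := h U hU
  have := rootFidelity_le_one_sub_discord hlam hunit hρ' hU'
  simp only at h1
  linarith

lemma rootFidelity_le_conj {ρ σ : Matrix n n ℂ} (hρ : ρ.PosSemidef) (hσ : σ.PosSemidef)
    {W : Matrix n n ℂ} (hW : W ∈ unitaryGroup n ℂ) :
    rootFidelity ρ σ ≤ rootFidelity (W * ρ * Wᴴ) (W * σ * Wᴴ) := by
  obtain ⟨P, Q, rfl, rfl, h⟩ := exists_factors_trace_eq_rootFidelity hρ hσ
  have e : ∀ X Y : Matrix n n ℂ, (W * X) * (W * Y)ᴴ = W * (X * Yᴴ) * Wᴴ := fun X Y => by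
    rw [conjTranspose_mul]; simp only [mul_assoc]
  have := trace_mul_le_rootFidelity (e P P) (e Q Q)
  rw [e, trace_mul_comm, ← mul_assoc, conjTranspose_mul_self_of_mem hW, one_mul, h] at this
  exact this

lemma perturb_conj_kronecker {V : Matrix A A ℂ} {W : Matrix B B ℂ} (hV : V ∈ unitaryGroup A ℂ)
    (U : Matrix A A ℂ) (ρ : Matrix (A × B) (A × B) ℂ) :
    perturb (V * U * Vᴴ) (V ⊗ₖ W * ρ * (V ⊗ₖ W)ᴴ) =
      V ⊗ₖ W * perturb U ρ * (V ⊗ₖ W)ᴴ := by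
  have h : ((V * U * Vᴴ) ⊗ₖ (1 : Matrix B B ℂ)) * (V ⊗ₖ W) = V ⊗ₖ W * (U ⊗ₖ 1) := by
    rw [← mul_kronecker_mul, ← mul_kronecker_mul, mul_assoc _ Vᴴ,
      conjTranspose_mul_self_of_mem hV, mul_one, mul_one, one_mul]
  have h' := congrArg conjTranspose h
  rw [conjTranspose_mul, conjTranspose_mul] at h'
  rw [perturb, perturb, ← mul_assoc, ← mul_assoc, h, mul_assoc _ (V ⊗ₖ W)ᴴ, h']
  simp only [mul_assoc]

lemma discordOfResponse_conj_le {lam : Fin (Fintype.card A) → ℂ}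
    (hlam : Function.Injective lam) (hunit : ∀ k, ‖lam k‖ = 1) {ρ : Matrix (A × B) (A × B) ℂ}
    (hρ : ρ.PosSemidef) {V : Matrix A A ℂ} {W : Matrix B B ℂ} (hV : V ∈ unitaryGroup A ℂ)
    (hW : W ∈ unitaryGroup B ℂ) :
    discordOfResponse lam (V ⊗ₖ W * ρ * (V ⊗ₖ W)ᴴ) ≤ discordOfResponse lam ρ := by
  refine discordOfResponse_le_of_forall hlam hunit hρ (hρ.mul_mul_conjTranspose_same _)
    fun U hU => ⟨V * U * Vᴴ, conj_mem_unitariesWithSpectrum hU hV, ?_⟩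
  rw [perturb_conj_kronecker hV]
  exact rootFidelity_le_conj hρ (hρ.mul_mul_conjTranspose_same _) (kronecker_mem_unitary hV hW)

lemma discordOfResponse_conj {lam : Fin (Fintype.card A) → ℂ}
    (hlam : Function.Injective lam) (hunit : ∀ k, ‖lam k‖ = 1) {ρ : Matrix (A × B) (A × B) ℂ}
    (hρ : ρ.PosSemidef) {V : Matrix A A ℂ} {W : Matrix B B ℂ} (hV : V ∈ unitaryGroup A ℂ)
    (hW : W ∈ unitaryGroup B ℂ) :
    discordOfResponse lam (V ⊗ₖ W * ρ * (V ⊗ₖ W)ᴴ) = discordOfResponse lam ρ := by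
  refine le_antisymm (discordOfResponse_conj_le hlam hunit hρ hV hW) ?_
  have h := discordOfResponse_conj_le hlam hunit (hρ.mul_mul_conjTranspose_same (V ⊗ₖ W))
    (conjTranspose_mem_unitaryGroup hV) (conjTranspose_mem_unitaryGroup hW)
  have e : Vᴴ ⊗ₖ Wᴴ * (V ⊗ₖ W * ρ * (V ⊗ₖ W)ᴴ) * (Vᴴ ⊗ₖ Wᴴ)ᴴ = ρ := by
    have h1 := conjTranspose_mul_self_of_mem (kronecker_mem_unitary hV hW)
    rw [← conjTranspose_kronecker, conjTranspose_conjTranspose, mul_assoc, mul_assoc, h1,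
      mul_one, ← mul_assoc, h1, one_mul]
  rwa [e] at h

/-! ### Channels on the second subsystem -/

/-- Complete positivity for an arbitrary finite ancilla. -/
lemma IsCPTP.posSemidef_ampliation {K : Type*} [Fintype K] {Φ : Matrix B B ℂ →ₗ[ℂ] Matrix C C ℂ}
    (hΦ : IsCPTP Φ) {X : Matrix (K × B) (K × B) ℂ} (hX : X.PosSemidef) :
    (ampliation Φ X).PosSemidef := by
  let e := (Fintype.equivFin K).symm
  have h := hΦ.completelyPositive _ _ (hX.submatrix (e.prodCongr (Equiv.refl B)))
  have h2 := h.submatrix (e.symm.prodCongr (Equiv.refl C))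
  convert h2 using 1
  ext ⟨i, c⟩ ⟨j, c'⟩
  simp [ampliation, submatrix, of_apply]

lemma IsCPTP.trace_ampliation {K : Type*} [Fintype K] {Φ : Matrix B B ℂ →ₗ[ℂ] Matrix C C ℂ}
    (hΦ : IsCPTP Φ) (X : Matrix (K × B) (K × B) ℂ) : (ampliation Φ X).trace = X.trace := by
  have h : ∀ i : K, (Φ (of fun b b' => X (i, b) (i, b'))).trace = ∑ b, X (i, b) (i, b) :=
    fun i => by rw [hΦ.tracePreserving]; rfl
  simp only [trace, diag, Fintype.sum_prod_type] at h ⊢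
  exact Finset.sum_congr rfl fun i _ => h i

lemma ampliation_kronecker_mul {Φ : Matrix B B ℂ →ₗ[ℂ] Matrix C C ℂ} (U : Matrix A A ℂ)
    (X : Matrix (A × B) (A × B) ℂ) :
    ampliation Φ (U ⊗ₖ (1 : Matrix B B ℂ) * X) = U ⊗ₖ (1 : Matrix C C ℂ) * ampliation Φ X := by
  ext ⟨i, c⟩ ⟨j, c'⟩
  have : (of fun b b' => (U ⊗ₖ (1 : Matrix B B ℂ) * X) (i, b) (j, b'))
      = ∑ k, U i k • (of fun b b' => X (k, b) (j, b')) := by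
    ext b b'
    rw [Matrix.sum_apply]
    simp [mul_apply, Fintype.sum_prod_type, one_apply]
  simp only [ampliation, of_apply]
  rw [this, map_sum, Matrix.sum_apply]
  simp only [map_smul, Matrix.smul_apply, mul_apply, of_apply, Fintype.sum_prod_type,
    kroneckerMap_apply, one_apply]
  simp

lemma ampliation_mul_kronecker {Φ : Matrix B B ℂ →ₗ[ℂ] Matrix C C ℂ} (U : Matrix A A ℂ)
    (X : Matrix (A × B) (A × B) ℂ) :
    ampliation Φ (X * U ⊗ₖ (1 : Matrix B B ℂ)) = ampliation Φ X * U ⊗ₖ (1 : Matrix C C ℂ) := by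
  ext ⟨i, c⟩ ⟨j, c'⟩
  have : (of fun b b' => (X * U ⊗ₖ (1 : Matrix B B ℂ)) (i, b) (j, b'))
      = ∑ k, U k j • (of fun b b' => X (i, b) (k, b')) := by
    ext b b'
    rw [Matrix.sum_apply]
    simp [mul_apply, Fintype.sum_prod_type, one_apply, mul_comm]
  simp only [ampliation, of_apply]
  rw [this, map_sum, Matrix.sum_apply]
  simp only [map_smul, Matrix.smul_apply, mul_apply, of_apply, Fintype.sum_prod_type,
    kroneckerMap_apply, one_apply]
  simp [mul_comm]

lemma perturb_ampliation {Φ : Matrix B B ℂ →ₗ[ℂ] Matrix C C ℂ} (U : Matrix A A ℂ)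
    (X : Matrix (A × B) (A × B) ℂ) :
    perturb U (ampliation Φ X) = ampliation Φ (perturb U X) := by
  simp only [perturb, conjTranspose_kronecker, conjTranspose_one, ampliation_mul_kronecker,
    ampliation_kronecker_mul]

/-- The root fidelity does not decrease under `id ⊗ Φ`: apply `Φ` with a two-level ancilla to the
positive block matrix that attains the root fidelity. -/
lemma IsCPTP.rootFidelity_le_ampliation {Φ : Matrix B B ℂ →ₗ[ℂ] Matrix C C ℂ} (hΦ : IsCPTP Φ)
    {ρ σ : Matrix (A × B) (A × B) ℂ} (hρ : ρ.PosSemidef) (hσ : σ.PosSemidef) :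
    rootFidelity ρ σ ≤ rootFidelity (ampliation Φ ρ) (ampliation Φ σ) := by
  obtain ⟨X, hX, h⟩ := exists_posSemidef_trace_eq_rootFidelity hρ hσ
  let f := Equiv.sumProdDistrib A A B
  let g := Equiv.sumProdDistrib A A C
  have h1 := (hΦ.posSemidef_ampliation (hX.submatrix f)).submatrix g.symm
  have e : (ampliation Φ ((fromBlocks ρ X Xᴴ σ).submatrix f f)).submatrix
      g.symm g.symm = fromBlocks (ampliation Φ ρ) (ampliation Φ X) (ampliation Φ Xᴴ)
        (ampliation Φ σ) := by
    ext (⟨i, c⟩ | ⟨i, c⟩) (⟨j, c'⟩ | ⟨j, c'⟩) <;> rfl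
  rw [e] at h1
  rw [← (isHermitian_fromBlocks_iff.1 h1.isHermitian).2.1] at h1
  have := trace_le_rootFidelity_of_posSemidef h1
  rwa [hΦ.trace_ampliation, h] at this

lemma IsCPTP.discordOfResponse_ampliation_le {lam : Fin (Fintype.card A) → ℂ}
    (hlam : Function.Injective lam) (hunit : ∀ k, ‖lam k‖ = 1) {ρ : Matrix (A × B) (A × B) ℂ}
    (hρ : ρ.PosSemidef) {Φ : Matrix B B ℂ →ₗ[ℂ] Matrix C C ℂ} (hΦ : IsCPTP Φ) :
    discordOfResponse lam (ampliation Φ ρ) ≤ discordOfResponse lam ρ := by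
  refine discordOfResponse_le_of_forall hlam hunit hρ (hΦ.posSemidef_ampliation hρ)
    fun U hU => ⟨U, hU, ?_⟩
  rw [perturb_ampliation]
  exact hΦ.rootFidelity_le_ampliation hρ (hρ.mul_mul_conjTranspose_same _)
end

section
variable {A B n : Type*} [Fintype A] [DecidableEq A] [Fintype B] [DecidableEq B]
  [Fintype n] [DecidableEq n]

/-! ### Classical-quantum states -/

lemma trace_ketbra (φ : EuclideanSpace ℂ n) : (ketbra φ).trace = (‖φ‖ : ℂ) ^ 2 := by
  refine Eq.trans ?_ (inner_self_eq_norm_sq_to_K (𝕜 := ℂ) φ)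
  rw [PiLp.inner_apply]
  simp [ketbra, trace, vecMulVec_apply, Complex.mul_conj, Complex.normSq_eq_norm_sq]

lemma isState_ketbra {φ : EuclideanSpace ℂ n} (hφ : ‖φ‖ = 1) : IsState (ketbra φ) :=
  ⟨posSemidef_vecMulVec_self_star _, by rw [trace_ketbra, hφ]; simp⟩

lemma ketbra_eq_conj_single {v : n → EuclideanSpace ℂ n} (i : n) :
    ketbra (v i) = colMatrix v * single i i (1 : ℂ) * (colMatrix v)ᴴ := by
  ext a b
  rw [mul_assoc]
  simp [ketbra, vecMulVec_apply, colMatrix, mul_apply, single_apply, ite_and]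

lemma conj_kronecker_one (V : Matrix A A ℂ) (X : Matrix A A ℂ) (τ : Matrix B B ℂ) :
    V ⊗ₖ (1 : Matrix B B ℂ) * (X ⊗ₖ τ) * (V ⊗ₖ (1 : Matrix B B ℂ))ᴴ = (V * X * Vᴴ) ⊗ₖ τ := by
  rw [conjTranspose_kronecker, conjTranspose_one, ← mul_kronecker_mul, ← mul_kronecker_mul,
    one_mul, mul_one]

/-- A block-diagonal state, in any orthonormal basis of the first subsystem, is
classical-quantum. Blocks of trace zero vanish; for these an arbitrary state is chosen. -/
lemma isClassicalQuantum_of_blocks [Nonempty B] {V : Matrix A A ℂ} (hV : V ∈ unitaryGroup A ℂ)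
    {τ : A → Matrix B B ℂ} (hτ : ∀ i, (τ i).PosSemidef) (h1 : ∑ i, (τ i).trace = 1) :
    IsClassicalQuantum (V ⊗ₖ (1 : Matrix B B ℂ) * (∑ i, single i i (1 : ℂ) ⊗ₖ τ i) *
      (V ⊗ₖ (1 : Matrix B B ℂ))ᴴ) := by
  obtain ⟨e, he⟩ := exists_orthonormalBasis_colMatrix_eq hV
  obtain ⟨b⟩ := ‹Nonempty B›
  have htr : ∀ i, (τ i).trace = ((τ i).trace.re : ℂ) := fun i =>
    Complex.ext rfl (by simpa using (Complex.nonneg_iff.1 (hτ i).trace_nonneg).2.symm)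
  let σ : A → Matrix B B ℂ := fun i => if (τ i).trace.re = 0 then
    ketbra (EuclideanSpace.single b 1) else (((τ i).trace.re)⁻¹ : ℝ) • τ i
  have hσ : ∀ i, ((τ i).trace.re : ℂ) • σ i = τ i := by
    intro i
    by_cases h : (τ i).trace.re = 0
    · have : τ i = 0 := by rw [← (hτ i).trace_eq_zero_iff, htr, h, Complex.ofReal_zero]
      simp [this]
    · have hc : ((τ i).trace.re : ℂ) ≠ 0 := Complex.ofReal_ne_zero.2 h
      ext x y
      simp [σ, h]
  refine ⟨e, fun i => (τ i).trace.re, σ, fun i => trace_re_nonneg (hτ i), ?_, fun i => ?_, ?_⟩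
  · rw [← Complex.re_sum, h1, Complex.one_re]
  · by_cases h : (τ i).trace.re = 0
    · simp only [σ, h, if_true]
      exact isState_ketbra (by simp)
    · simp only [σ, h, if_false]
      refine ⟨(hτ i).smul (inv_nonneg.2 (trace_re_nonneg (hτ i))), ?_⟩
      rw [trace_smul, htr i]
      simp [h]
  · rw [Finset.mul_sum, Finset.sum_mul]
    refine Finset.sum_congr rfl fun i _ => ?_
    rw [conj_kronecker_one, ← he, ← ketbra_eq_conj_single, ← kronecker_smul, hσ]

/-- A matrix on the bipartite space that commutes with `D ⊗ 1`, for a diagonal `D` with distinct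
entries, is block diagonal. -/
lemma eq_sum_single_kronecker_of_commute {d : A → ℂ} (hd : Function.Injective d)
    {ρ : Matrix (A × B) (A × B) ℂ}
    (h : diagonal d ⊗ₖ (1 : Matrix B B ℂ) * ρ = ρ * diagonal d ⊗ₖ (1 : Matrix B B ℂ)) :
    ρ = ∑ i, single i i (1 : ℂ) ⊗ₖ ρ.submatrix (Prod.mk i) (Prod.mk i) := by
  ext ⟨i, b⟩ ⟨j, b'⟩
  rw [Matrix.sum_apply]
  simp only [kroneckerMap_apply, single_apply, submatrix_apply]
  rw [← diagonal_one, diagonal_kronecker_diagonal] at h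
  have h1 := congrFun (congrFun h (i, b)) (j, b')
  rw [diagonal_mul, mul_diagonal] at h1
  by_cases hij : i = j
  · subst hij
    simp
  · have : d i - d j ≠ 0 := sub_ne_zero.2 (hd.ne hij)
    have h0 : ρ (i, b) (j, b') = 0 := by
      have : (d i - d j) * ρ (i, b) (j, b') = 0 := by linear_combination h1
      simpa [sub_ne_zero.2 (hd.ne hij)] using this
    rw [h0]
    symm
    refine Finset.sum_eq_zero fun k _ => ?_
    rw [if_neg (fun hk => hij (hk.1.symm.trans hk.2)), zero_mul]

lemma isClassicalQuantum_of_perturb_eq [Nonempty B] {lam : Fin (Fintype.card A) → ℂ}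
    (hlam : Function.Injective lam) (hunit : ∀ k, ‖lam k‖ = 1) {ρ : Matrix (A × B) (A × B) ℂ}
    (hρ : IsState ρ) {U : Matrix A A ℂ} (hU : U ∈ unitariesWithSpectrum lam)
    (h : perturb U ρ = ρ) : IsClassicalQuantum ρ := by
  obtain ⟨V, hV, hUV⟩ := (mem_unitariesWithSpectrum_iff hlam hunit).1 hU
  have hV1 := kronecker_one_mem (B := B) hV
  have hVh : Vᴴ ⊗ₖ (1 : Matrix B B ℂ) = (V ⊗ₖ (1 : Matrix B B ℂ))ᴴ := by
    rw [conjTranspose_kronecker, conjTranspose_one]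
  set V₁ := V ⊗ₖ (1 : Matrix B B ℂ) with hV₁
  set ρ' := V₁ᴴ * ρ * V₁ with hρ'
  have hback : V₁ * ρ' * V₁ᴴ = ρ := by
    rw [hρ', ← mul_assoc, ← mul_assoc, mul_conjTranspose_self_of_mem hV1, one_mul, mul_assoc,
      mul_conjTranspose_self_of_mem hV1, mul_one]
  have hstate : IsState ρ' := by
    simpa using hρ.conj (conjTranspose_mem_unitaryGroup hV1)
  have hcomm : spectrumMatrix lam ⊗ₖ (1 : Matrix B B ℂ) * ρ' =
      ρ' * spectrumMatrix lam ⊗ₖ (1 : Matrix B B ℂ) := by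
    have h1 : U ⊗ₖ (1 : Matrix B B ℂ) * ρ = ρ * U ⊗ₖ (1 : Matrix B B ℂ) := by
      conv_rhs => rw [← h, perturb]
      rw [mul_assoc, conjTranspose_mul_self_of_mem (kronecker_one_mem hU.1), mul_one]
    have h2 : U ⊗ₖ (1 : Matrix B B ℂ) = V₁ * spectrumMatrix lam ⊗ₖ (1 : Matrix B B ℂ) * V₁ᴴ := by
      rw [conj_kronecker_one, hUV]
    rw [h2] at h1
    have h3 : V₁ᴴ * V₁ = 1 := conjTranspose_mul_self_of_mem hV1
    have h4 := congrArg (fun X => V₁ᴴ * X * V₁) h1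
    calc _ = (V₁ᴴ * V₁) * (spectrumMatrix lam ⊗ₖ (1 : Matrix B B ℂ)) * (V₁ᴴ * ρ * V₁) := by
          rw [h3, one_mul]
      _ = V₁ᴴ * (V₁ * spectrumMatrix lam ⊗ₖ (1 : Matrix B B ℂ) * V₁ᴴ * ρ) * V₁ := by
          simp only [mul_assoc]
      _ = (V₁ᴴ * ρ * V₁) * (spectrumMatrix lam ⊗ₖ (1 : Matrix B B ℂ)) * (V₁ᴴ * V₁) := by
          rw [h4]; simp only [mul_assoc]
      _ = _ := by rw [h3, mul_one]
  have hblk := eq_sum_single_kronecker_of_commute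
    (hlam.comp (Fintype.equivFin A).injective) hcomm
  rw [← hback, hblk]
  refine isClassicalQuantum_of_blocks hV (fun i => hstate.1.submatrix _) ?_
  rw [← hstate.2]
  simp only [trace, diag, Fintype.sum_prod_type, submatrix_apply]

lemma IsClassicalQuantum.exists_perturb_eq {lam : Fin (Fintype.card A) → ℂ}
    (hunit : ∀ k, ‖lam k‖ = 1) {ρ : Matrix (A × B) (A × B) ℂ} (hρ : IsClassicalQuantum ρ) :
    ∃ U ∈ unitariesWithSpectrum lam, perturb U ρ = ρ := by
  obtain ⟨e, p, σ, -, -, -, rfl⟩ := hρ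
  have hV := colMatrix_mem_unitaryGroup_iff.2 e.orthonormal
  set V := colMatrix e with hVdef
  have hD := (spectrumMatrix_mem (A := A) hunit)
  refine ⟨V * spectrumMatrix lam * Vᴴ, conj_mem_unitariesWithSpectrum hD hV, ?_⟩
  rw [perturb, Finset.mul_sum, Finset.sum_mul]
  refine Finset.sum_congr rfl fun i _ => ?_
  rw [Matrix.mul_smul, Matrix.smul_mul, conj_kronecker_one]
  congr 2
  have hs : spectrumMatrix lam * single i i (1 : ℂ) * (spectrumMatrix lam)ᴴ = single i i 1 := by
    ext a b
    rw [spectrumMatrix, diagonal_conjTranspose, mul_diagonal, diagonal_mul]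
    by_cases hab : i = a ∧ i = b
    · obtain ⟨rfl, rfl⟩ := hab
      simp [Complex.mul_conj, Complex.normSq_eq_norm_sq, hunit]
    · simp [hab]
  have h3 := conjTranspose_mul_self_of_mem hV
  rw [ketbra_eq_conj_single, ← hVdef]
  calc _ = V * (spectrumMatrix lam * ((Vᴴ * V) * single i i (1 : ℂ) * (Vᴴ * V)) *
        (spectrumMatrix lam)ᴴ) * Vᴴ := by
        simp only [conjTranspose_mul, conjTranspose_conjTranspose, mul_assoc]
    _ = _ := by rw [h3, one_mul, mul_one, hs]

lemma discordOfResponse_eq_zero_iff [Nonempty B] {lam : Fin (Fintype.card A) → ℂ}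
    (hlam : Function.Injective lam) (hunit : ∀ k, ‖lam k‖ = 1) {ρ : Matrix (A × B) (A × B) ℂ}
    (hρ : IsState ρ) : discordOfResponse lam ρ = 0 ↔ IsClassicalQuantum ρ := by
  constructor
  · intro h0
    obtain ⟨U, hU, h⟩ := (isGreatest_rootFidelity hlam hunit hρ.1).1
    rw [h0, sub_zero] at h
    exact isClassicalQuantum_of_perturb_eq hlam hunit hρ hU
      (eq_of_rootFidelity_eq_one hρ (hρ.perturb hU.1) h).symm
  · intro h
    obtain ⟨U, hU, hUρ⟩ := h.exists_perturb_eq hunit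
    have h1 := rootFidelity_le_one_sub_discord hlam hunit hρ.1 hU
    rw [hUρ, rootFidelity_self hρ] at h1
    have h2 := discordOfResponse_nonneg hlam hunit hρ
    linarith
end

section
variable {A B n : Type*} [Fintype A] [DecidableEq A] [Fintype B] [DecidableEq B]
  [Fintype n] [DecidableEq n]

/-! ### Fidelity of pure states -/

lemma mul_ketbra_mul_conjTranspose (W : Matrix n n ℂ) (φ : EuclideanSpace ℂ n) :
    W * ketbra φ * Wᴴ = ketbra (toEuclideanLin W φ) := by
  rw [ketbra, ketbra, mul_vecMulVec, vecMulVec_mul, ofLp_toLpLin, toLin'_apply, star_mulVec]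

lemma perturb_ketbra (U : Matrix A A ℂ) (φ : EuclideanSpace ℂ (A × B)) :
    perturb U (ketbra φ) = ketbra (toEuclideanLin (U ⊗ₖ (1 : Matrix B B ℂ)) φ) :=
  mul_ketbra_mul_conjTranspose _ _

lemma star_dotProduct_eq_inner (φ ψ : EuclideanSpace ℂ n) :
    star φ.ofLp ⬝ᵥ ψ.ofLp = inner ℂ φ ψ := by
  rw [EuclideanSpace.inner_eq_star_dotProduct, dotProduct_comm]

lemma ketbra_mul_ketbra_mul_ketbra (φ ψ : EuclideanSpace ℂ n) :
    ketbra φ * ketbra ψ * ketbra φ = ((‖(inner ℂ φ ψ : ℂ)‖ ^ 2 : ℝ) : ℂ) • ketbra φ := by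
  rw [ketbra, ketbra, vecMulVec_mul_vecMulVec, vecMulVec_mul_vecMulVec,
    star_dotProduct_eq_inner, smul_dotProduct, star_dotProduct_eq_inner,
    vecMulVec_smul, ← inner_conj_symm ψ φ, smul_eq_mul, Complex.mul_conj, Complex.normSq_eq_norm_sq]

lemma rootFidelity_ketbra {φ : EuclideanSpace ℂ n} (hφ : ‖φ‖ = 1) (ψ : EuclideanSpace ℂ n) :
    rootFidelity (ketbra φ) (ketbra ψ) = ‖(inner ℂ φ ψ : ℂ)‖ := by
  have hpos : (0 : Matrix n n ℂ) ≤ ketbra φ := nonneg_iff_posSemidef.2 (isState_ketbra hφ).1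
  have hidem : ketbra φ * ketbra φ = ketbra φ := by
    rw [ketbra, vecMulVec_mul_vecMulVec, star_dotProduct_eq_inner, inner_self_eq_norm_sq_to_K, hφ]
    simp
  have h1 : CFC.sqrt (ketbra φ) = ketbra φ := CFC.sqrt_unique hidem hpos
  set c := ‖(inner ℂ φ ψ : ℂ)‖ with hc
  have h2 : CFC.sqrt (((c ^ 2 : ℝ) : ℂ) • ketbra φ) = (c : ℂ) • ketbra φ := by
    refine CFC.sqrt_unique ?_ (nonneg_iff_posSemidef.2 ?_)
    · rw [Matrix.smul_mul, Matrix.mul_smul, hidem, smul_smul]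
      push_cast
      rw [sq]
    · exact (isState_ketbra hφ).1.smul (Complex.zero_le_real.2 (norm_nonneg _))
  rw [rootFidelity, h1, ketbra_mul_ketbra_mul_ketbra, h2, trace_smul, trace_ketbra, hφ]
  simp

/-! ### Pure states and the reduced state -/

/-- The coefficients of a bipartite vector as a matrix `Φ`; the reduced state of the first
subsystem is `Φ Φᴴ`. -/
def coeffMatrix (φ : EuclideanSpace ℂ (A × B)) : Matrix A B ℂ := of fun a b => φ (a, b)

/-- The reduced operator `Tr_B |φ⟩⟨φ|` of the first subsystem. -/
noncomputable def reducedState (φ : EuclideanSpace ℂ (A × B)) : Matrix A A ℂ :=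
  coeffMatrix φ * (coeffMatrix φ)ᴴ

lemma coeffMatrix_smul (c : ℂ) (φ : EuclideanSpace ℂ (A × B)) :
    coeffMatrix (c • φ) = c • coeffMatrix φ := rfl

lemma coeffMatrix_kronecker_one (M : Matrix A A ℂ) (φ : EuclideanSpace ℂ (A × B)) :
    coeffMatrix (toEuclideanLin (M ⊗ₖ (1 : Matrix B B ℂ)) φ) = M * coeffMatrix φ := by
  ext a b
  simp [coeffMatrix, mul_apply, mulVec, dotProduct, Fintype.sum_prod_type, one_apply]

lemma coeffMatrix_one_kronecker (M : Matrix B B ℂ) (φ : EuclideanSpace ℂ (A × B)) :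
    coeffMatrix (toEuclideanLin ((1 : Matrix A A ℂ) ⊗ₖ M) φ) = coeffMatrix φ * Mᵀ := by
  ext a b
  simp [coeffMatrix, mul_apply, mulVec, dotProduct, Fintype.sum_prod_type, one_apply,
    mul_comm]

lemma inner_eq_trace_coeffMatrix (φ ψ : EuclideanSpace ℂ (A × B)) :
    inner ℂ φ ψ = (coeffMatrix ψ * (coeffMatrix φ)ᴴ).trace := by
  simp [PiLp.inner_apply, Fintype.sum_prod_type, trace, coeffMatrix, mul_apply]

lemma inner_kronecker_one (U : Matrix A A ℂ) (φ : EuclideanSpace ℂ (A × B)) :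
    inner ℂ φ (toEuclideanLin (U ⊗ₖ (1 : Matrix B B ℂ)) φ) = (U * reducedState φ).trace := by
  rw [inner_eq_trace_coeffMatrix, coeffMatrix_kronecker_one, reducedState, Matrix.mul_assoc]

lemma norm_sq_eq_trace_reducedState (φ : EuclideanSpace ℂ (A × B)) :
    ‖φ‖ ^ 2 = (reducedState φ).trace.re := by
  rw [← inner_self_eq_norm_sq (𝕜 := ℂ) φ, inner_eq_trace_coeffMatrix]
  rfl

lemma reducedState_real_smul (r : ℝ) (φ : EuclideanSpace ℂ (A × B)) :
    reducedState ((r : ℂ) • φ) = ((r ^ 2 : ℝ) : ℂ) • reducedState φ := by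
  rw [reducedState, coeffMatrix_smul, conjTranspose_smul, Matrix.smul_mul, Matrix.mul_smul,
    smul_smul, reducedState]
  simp [sq]

/-- The largest overlap `|Tr (U τ)|` of `τ` with a unitary in `Λ`. -/
noncomputable def maxOverlap (lam : Fin (Fintype.card A) → ℂ) (τ : Matrix A A ℂ) : ℝ :=
  sSup ((fun U => ‖(U * τ).trace‖) '' unitariesWithSpectrum lam)

section
variable {lam : Fin (Fintype.card A) → ℂ}

lemma isGreatest_maxOverlap (hlam : Function.Injective lam) (hunit : ∀ k, ‖lam k‖ = 1)
    (τ : Matrix A A ℂ) :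
    IsGreatest ((fun U => ‖(U * τ).trace‖) '' unitariesWithSpectrum lam) (maxOverlap lam τ) := by
  refine IsCompact.isGreatest_sSup ((isCompact_unitariesWithSpectrum hlam hunit).image ?_)
    ⟨_, _, spectrumMatrix_mem hunit, rfl⟩
  exact continuous_norm.comp (Continuous.matrix_trace (by fun_prop))

lemma maxOverlap_sum_le (hlam : Function.Injective lam) (hunit : ∀ k, ‖lam k‖ = 1)
    {ι : Type*} (s : Finset ι) (τ : ι → Matrix A A ℂ) :
    maxOverlap lam (∑ i ∈ s, τ i) ≤ ∑ i ∈ s, maxOverlap lam (τ i) := by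
  obtain ⟨U, hU, h⟩ := (isGreatest_maxOverlap hlam hunit (∑ i ∈ s, τ i)).1
  rw [← h]
  simp only
  rw [Finset.mul_sum, trace_sum]
  exact (norm_sum_le _ _).trans
    (Finset.sum_le_sum fun i _ => (isGreatest_maxOverlap hlam hunit (τ i)).2 ⟨U, hU, rfl⟩)

lemma maxOverlap_smul_le (hlam : Function.Injective lam) (hunit : ∀ k, ‖lam k‖ = 1)
    (c : ℂ) (τ : Matrix A A ℂ) : ‖c‖ * maxOverlap lam τ ≤ maxOverlap lam (c • τ) := by
  obtain ⟨U, hU, h⟩ := (isGreatest_maxOverlap hlam hunit τ).1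
  have := (isGreatest_maxOverlap hlam hunit (c • τ)).2 ⟨U, hU, rfl⟩
  simp only at h
  simpa only [← h, Matrix.mul_smul, trace_smul, norm_smul] using this

lemma maxOverlap_conj_le (hlam : Function.Injective lam) (hunit : ∀ k, ‖lam k‖ = 1)
    {V : Matrix A A ℂ} (hV : V ∈ unitaryGroup A ℂ) (τ : Matrix A A ℂ) :
    maxOverlap lam τ ≤ maxOverlap lam (V * τ * Vᴴ) := by
  obtain ⟨U, hU, h⟩ := (isGreatest_maxOverlap hlam hunit τ).1
  have h1 := (isGreatest_maxOverlap hlam hunit (V * τ * Vᴴ)).2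
    ⟨V * U * Vᴴ, conj_mem_unitariesWithSpectrum hU hV, rfl⟩
  have e : (V * U * Vᴴ * (V * τ * Vᴴ)).trace = (U * τ).trace := by
    have h3 := conjTranspose_mul_self_of_mem hV
    have : V * U * Vᴴ * (V * τ * Vᴴ) = V * (U * (Vᴴ * V) * τ * Vᴴ) := by
      simp only [mul_assoc]
    rw [this, h3, trace_mul_comm, mul_one, mul_assoc _ Vᴴ, h3, mul_one]
  simp only [e] at h1
  exact h ▸ h1

/-- On pure states the discord of response is a function of the reduced state. -/
lemma discordOfResponse_ketbra {φ : EuclideanSpace ℂ (A × B)} (hφ : ‖φ‖ = 1) :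
    discordOfResponse lam (ketbra φ) = 1 - maxOverlap lam (reducedState φ) := by
  rw [discordOfResponse, maxOverlap]
  congr 2
  refine Set.image_congr fun U _ => ?_
  rw [perturb_ketbra, rootFidelity_ketbra hφ, inner_kronecker_one]

/-- A decomposition of a pure state into (unnormalized) branches `ψ i` does not increase the
average discord, provided the overlap function is subadditive along it. -/
lemma sum_discordOfResponse_branches_le (hlam : Function.Injective lam)
    (hunit : ∀ k, ‖lam k‖ = 1) {ι : Type*} [Fintype ι] {φ : EuclideanSpace ℂ (A × B)}
    (hφ : ‖φ‖ = 1) (ψ : ι → EuclideanSpace ℂ (A × B)) (hsum : ∑ i, ‖ψ i‖ ^ 2 = 1)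
    (hle : maxOverlap lam (reducedState φ) ≤ ∑ i, maxOverlap lam (reducedState (ψ i))) :
    ∑ i, ‖ψ i‖ ^ 2 * discordOfResponse lam (ketbra ((‖ψ i‖⁻¹ : ℂ) • ψ i)) ≤
      discordOfResponse lam (ketbra φ) := by
  -- For `ψ i = 0` the normalized branch is a junk value, but it carries the weight zero.
  have key : ∀ i, ‖ψ i‖ ^ 2 * discordOfResponse lam (ketbra ((‖ψ i‖⁻¹ : ℂ) • ψ i)) ≤
      ‖ψ i‖ ^ 2 - maxOverlap lam (reducedState (ψ i)) := by
    intro i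
    by_cases h0 : ψ i = 0
    · obtain ⟨U, -, h⟩ := (isGreatest_maxOverlap hlam hunit (reducedState (ψ i))).1
      have : reducedState (ψ i) = 0 := by
        rw [h0]; ext a b; simp [reducedState, coeffMatrix, mul_apply]
      rw [this] at h ⊢
      simp only [Matrix.mul_zero, trace_zero, norm_zero] at h
      rw [← h, h0]
      simp
    · have hn : ‖ψ i‖ ≠ 0 := norm_ne_zero_iff.2 h0
      have h1 : ‖((‖ψ i‖⁻¹ : ℝ) : ℂ) • ψ i‖ = 1 := by simp [norm_smul, hn]
      rw [← Complex.ofReal_inv, discordOfResponse_ketbra h1, reducedState_real_smul]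
      have h2 := maxOverlap_smul_le hlam hunit ((‖ψ i‖ ^ 2 : ℝ) : ℂ)
        (((‖ψ i‖⁻¹ ^ 2 : ℝ) : ℂ) • reducedState (ψ i))
      have h3 := maxOverlap_smul_le hlam hunit ((‖ψ i‖⁻¹ ^ 2 : ℝ) : ℂ) (reducedState (ψ i))
      have h4 : ‖((‖ψ i‖⁻¹ ^ 2 : ℝ) : ℂ)‖ = ‖ψ i‖⁻¹ ^ 2 := by simp
      rw [h4] at h3
      have h5 : 0 ≤ ‖ψ i‖ ^ 2 := sq_nonneg _
      have h6 := mul_le_mul_of_nonneg_left h3 h5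
      have h7 : ‖ψ i‖ ^ 2 * (‖ψ i‖⁻¹ ^ 2 * maxOverlap lam (reducedState (ψ i)))
          = maxOverlap lam (reducedState (ψ i)) := by field_simp
      rw [h7] at h6
      linarith
  refine (Finset.sum_le_sum fun i _ => key i).trans ?_
  rw [Finset.sum_sub_distrib, hsum, discordOfResponse_ketbra hφ]
  linarith

/-! ### Monotonicity under LOCC -/

lemma reducedState_kronecker_one (M : Matrix A A ℂ) (φ : EuclideanSpace ℂ (A × B)) :
    reducedState (toEuclideanLin (M ⊗ₖ (1 : Matrix B B ℂ)) φ) = M * reducedState φ * Mᴴ := by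
  rw [reducedState, coeffMatrix_kronecker_one, conjTranspose_mul, reducedState]
  simp only [Matrix.mul_assoc]

lemma sum_reducedState_one_kronecker {ι : Type*} [Fintype ι] {M : ι → Matrix B B ℂ}
    (hM : ∑ i, (M i)ᴴ * M i = 1) (φ : EuclideanSpace ℂ (A × B)) :
    ∑ i, reducedState (toEuclideanLin ((1 : Matrix A A ℂ) ⊗ₖ M i) φ) = reducedState φ := by
  have h : ∀ i, reducedState (toEuclideanLin ((1 : Matrix A A ℂ) ⊗ₖ M i) φ) =
      coeffMatrix φ * ((M i)ᴴ * M i)ᵀ * (coeffMatrix φ)ᴴ := fun i => by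
    rw [reducedState, coeffMatrix_one_kronecker, conjTranspose_mul, transpose_mul]
    simp only [Matrix.mul_assoc]
    rfl
  simp only [h]
  rw [← Matrix.sum_mul, ← Matrix.mul_sum, ← transpose_sum, hM, transpose_one, Matrix.mul_one,
    reducedState]

/-- A measurement on the first subsystem turns the reduced state `τ` into `M i τ (M i)ᴴ`. With
`X = M i √τ` this is `X Xᴴ`, which by polar decomposition is unitarily equivalent to
`Xᴴ X = √τ (M i)ᴴ (M i) √τ`; the latter operators sum up to `τ`. -/
lemma maxOverlap_le_sum_measurement (hlam : Function.Injective lam) (hunit : ∀ k, ‖lam k‖ = 1)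
    {ι : Type*} [Fintype ι] {M : ι → Matrix A A ℂ} (hM : ∑ i, (M i)ᴴ * M i = 1)
    {τ : Matrix A A ℂ} (hτ : τ.PosSemidef) :
    maxOverlap lam τ ≤ ∑ i, maxOverlap lam (M i * τ * (M i)ᴴ) := by
  set s := CFC.sqrt τ with hs
  have hsH : sᴴ = s := conjTranspose_sqrt τ
  have hss : s * s = τ := sqrt_mul_sqrt hτ
  have hsum : ∑ i, s * ((M i)ᴴ * M i) * s = τ := by
    rw [← Finset.sum_mul, ← Finset.mul_sum, hM, mul_one, hss]
  refine (hsum ▸ maxOverlap_sum_le hlam hunit Finset.univ fun i => s * ((M i)ᴴ * M i) * s).trans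
    (Finset.sum_le_sum fun i _ => ?_)
  have hX : s * ((M i)ᴴ * M i) * s = (M i * s)ᴴ * (M i * s) := by
    rw [conjTranspose_mul, hsH]; simp only [mul_assoc]
  have hpos : (s * ((M i)ᴴ * M i) * s).PosSemidef := hX ▸ posSemidef_conjTranspose_mul_self _
  set r := CFC.sqrt (s * ((M i)ᴴ * M i) * s) with hr
  have hrr : r * r = s * ((M i)ᴴ * M i) * s := sqrt_mul_sqrt hpos
  have hrH : rᴴ = r := conjTranspose_sqrt _
  obtain ⟨W, hW, h⟩ := exists_unitary_mul_eq (T := M i * s) (S := r) (by rw [hrH, hrr, hX])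
  have e : M i * τ * (M i)ᴴ = W * (s * ((M i)ᴴ * M i) * s) * Wᴴ := by
    calc _ = (M i * s) * (M i * s)ᴴ := by
          rw [conjTranspose_mul, hsH, ← hss]; simp only [mul_assoc]
      _ = _ := by
          rw [h, conjTranspose_mul, hrH, ← hrr]; simp only [mul_assoc]
  rw [e]
  exact maxOverlap_conj_le hlam hunit hW _

lemma posSemidef_reducedState (φ : EuclideanSpace ℂ (A × B)) : (reducedState φ).PosSemidef :=
  posSemidef_self_mul_conjTranspose _

lemma norm_normalize {φ : EuclideanSpace ℂ n} (hφ : φ ≠ 0) : ‖(‖φ‖⁻¹ : ℂ) • φ‖ = 1 := by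
  have hn : ‖φ‖ ≠ 0 := norm_ne_zero_iff.2 hφ
  simp [norm_smul, hn]

lemma LOCC.average_discordOfResponse_le (hlam : Function.Injective lam)
    (hunit : ∀ k, ‖lam k‖ = 1) (P : LOCC A B) {φ : EuclideanSpace ℂ (A × B)} (hφ : ‖φ‖ = 1) :
    P.average (fun φ => discordOfResponse lam (ketbra φ)) φ ≤
      discordOfResponse lam (ketbra φ) := by
  -- Later rounds are handled by induction; branches of probability zero contribute nothing.
  have step : ∀ (next : LOCC A B) (ψ : EuclideanSpace ℂ (A × B)),
      (∀ {φ : EuclideanSpace ℂ (A × B)}, ‖φ‖ = 1 →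
        next.average (fun φ => discordOfResponse lam (ketbra φ)) φ ≤
          discordOfResponse lam (ketbra φ)) →
      ‖ψ‖ ^ 2 * next.average (fun φ => discordOfResponse lam (ketbra φ)) ((‖ψ‖⁻¹ : ℂ) • ψ) ≤
        ‖ψ‖ ^ 2 * discordOfResponse lam (ketbra ((‖ψ‖⁻¹ : ℂ) • ψ)) := by
    intro next ψ ih
    by_cases h0 : ψ = 0
    · simp [h0]
    · exact mul_le_mul_of_nonneg_left (ih (norm_normalize h0)) (sq_nonneg _)
  induction P generalizing φ with
  | done => exact le_rfl
  | measureA k M hM next ih =>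
    rw [LOCC.average]
    refine (Finset.sum_le_sum fun i _ => step _ _ fun h => ih i h).trans ?_
    refine sum_discordOfResponse_branches_le hlam hunit hφ _ ?_ ?_
    · simp only [norm_sq_eq_trace_reducedState, reducedState_kronecker_one]
      rw [← Complex.re_sum]
      simp only [trace_mul_comm _ (M _)ᴴ, ← mul_assoc]
      rw [← trace_sum, ← Finset.sum_mul, hM, one_mul, ← norm_sq_eq_trace_reducedState, hφ,
        one_pow]
    · simp only [reducedState_kronecker_one]
      exact maxOverlap_le_sum_measurement hlam hunit hM (posSemidef_reducedState φ)
  | measureB k M hM next ih =>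
    rw [LOCC.average]
    refine (Finset.sum_le_sum fun i _ => step _ _ fun h => ih i h).trans ?_
    refine sum_discordOfResponse_branches_le hlam hunit hφ _ ?_ ?_
    · simp only [norm_sq_eq_trace_reducedState]
      rw [← Complex.re_sum, ← trace_sum, sum_reducedState_one_kronecker hM,
        ← norm_sq_eq_trace_reducedState, hφ, one_pow]
    · conv_lhs => rw [← sum_reducedState_one_kronecker hM φ]
      exact maxOverlap_sum_le hlam hunit _ _

lemma ketbra_tensorVec (a : EuclideanSpace ℂ A) (b : EuclideanSpace ℂ B) :
    ketbra (tensorVec a b) = ketbra a ⊗ₖ ketbra b := by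
  ext x y
  simp [ketbra, tensorVec, vecMulVec_apply]
  ring

lemma norm_tensorVec {a : EuclideanSpace ℂ A} {b : EuclideanSpace ℂ B} (ha : ‖a‖ = 1)
    (hb : ‖b‖ = 1) : ‖tensorVec a b‖ = 1 := by
  have h := trace_ketbra (tensorVec a b)
  rw [ketbra_tensorVec, trace_kronecker, trace_ketbra, trace_ketbra, ha, hb] at h
  have h' : ‖tensorVec a b‖ ^ 2 = 1 := by
    rw [Complex.ofReal_one, one_pow, one_mul] at h
    exact_mod_cast h.symm
  nlinarith [norm_nonneg (tensorVec a b)]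

lemma isClassicalQuantum_ketbra_tensorVec {a : EuclideanSpace ℂ A} {b : EuclideanSpace ℂ B}
    (ha : ‖a‖ = 1) (hb : ‖b‖ = 1) : IsClassicalQuantum (ketbra (tensorVec a b)) := by
  have hA : Nonempty A := by
    by_contra h
    rw [not_nonempty_iff] at h
    have : a = 0 := Subsingleton.elim _ _
    simp [this] at ha
  obtain ⟨i₀⟩ := hA
  obtain ⟨e, he⟩ := Orthonormal.exists_orthonormalBasis_extension_of_card_eq (𝕜 := ℂ)
    (E := EuclideanSpace ℂ A) (ι := A) (by simp) (v := fun _ => a) (s := {i₀})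
    ⟨fun _ => ha, fun i j hij => absurd (Subsingleton.elim i j) hij⟩
  refine ⟨e, Pi.single i₀ 1, fun _ => ketbra b, fun i => ?_, by simp, fun _ => isState_ketbra hb,
    ?_⟩
  · by_cases h : i = i₀
    · subst h; simp
    · simp [h]
  · rw [Finset.sum_eq_single i₀ (fun i _ h => by simp [h]) (by simp), he i₀ rfl,
      ketbra_tensorVec]
    simp

lemma isPureEntanglementMonotone [Nonempty B] (hlam : Function.Injective lam)
    (hunit : ∀ k, ‖lam k‖ = 1) :
    IsPureEntanglementMonotone
      (fun φ : EuclideanSpace ℂ (A × B) => discordOfResponse lam (ketbra φ)) where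
  nonneg _ hφ := discordOfResponse_nonneg hlam hunit (isState_ketbra hφ)
  product _ _ ha hb :=
    (discordOfResponse_eq_zero_iff hlam hunit (isState_ketbra (norm_tensorVec ha hb))).2
      (isClassicalQuantum_ketbra_tensorVec ha hb)
  average_le P _ hφ := P.average_discordOfResponse_le hlam hunit hφ

/-! ### The entanglement of response -/

lemma fidelity_ketbra_perturb {φ : EuclideanSpace ℂ (A × B)} (hφ : ‖φ‖ = 1) (U : Matrix A A ℂ) :
    fidelity (ketbra φ) (perturb U (ketbra φ)) =
      ‖inner ℂ φ (toEuclideanLin (U ⊗ₖ (1 : Matrix B B ℂ)) φ)‖ ^ 2 := by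
  rw [fidelity, perturb_ketbra, rootFidelity_ketbra hφ]

lemma isGreatest_fidelity (hlam : Function.Injective lam)
    (hunit : ∀ k, ‖lam k‖ = 1) {ρ : Matrix (A × B) (A × B) ℂ} (hρ : ρ.PosSemidef) :
    IsGreatest ((fun U => fidelity ρ (perturb U ρ)) '' unitariesWithSpectrum lam)
      ((1 - discordOfResponse lam ρ) ^ 2) := by
  obtain ⟨⟨U, hU, h⟩, hub⟩ := isGreatest_rootFidelity hlam hunit hρ
  refine ⟨⟨U, hU, by rw [← h]; rfl⟩, ?_⟩
  rintro _ ⟨U', hU', rfl⟩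
  exact pow_le_pow_left₀ (rootFidelity_nonneg _ _) (hub ⟨U', hU', rfl⟩) 2

lemma one_sub_entanglementOfResponse (hlam : Function.Injective lam)
    (hunit : ∀ k, ‖lam k‖ = 1) {φ : EuclideanSpace ℂ (A × B)} (hφ : ‖φ‖ = 1) :
    1 - entanglementOfResponse lam φ = (1 - discordOfResponse lam (ketbra φ)) ^ 2 := by
  rw [entanglementOfResponse, (isGreatest_fidelity hlam hunit (isState_ketbra hφ).1).csSup_eq,
    sub_sub_cancel]

lemma strictMonoOn_one_sub_sqrt :
    StrictMonoOn (fun x : ℝ => 1 - Real.sqrt (1 - x)) (Set.Icc 0 1) := by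
  intro x hx y hy hxy
  have := Real.sqrt_lt_sqrt (sub_nonneg.2 hy.2) (sub_lt_sub_left hxy 1)
  simp only
  linarith

/-! ### Maximally entangled states -/

/-- The overlap `|Tr ((U ⊗ 1) ρ)|` bounds the root fidelity from below, for mixed states too. -/
lemma norm_trace_le_rootFidelity {ρ : Matrix (A × B) (A × B) ℂ} (hρ : ρ.PosSemidef)
    (U : Matrix A A ℂ) :
    ‖(U ⊗ₖ (1 : Matrix B B ℂ) * ρ).trace‖ ≤ rootFidelity ρ (perturb U ρ) := by
  set s := CFC.sqrt ρ with hs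
  have hsH : sᴴ = s := conjTranspose_sqrt ρ
  have hss : s * s = ρ := sqrt_mul_sqrt hρ
  set z := (U ⊗ₖ (1 : Matrix B B ℂ) * ρ).trace with hz
  obtain ⟨c, hc, hcz⟩ := Complex.exists_norm_eq_mul_self z
  have hcc : c * star c = 1 := by
    rw [Complex.star_def, Complex.mul_conj, Complex.normSq_eq_norm_sq, hc]; simp
  -- Compare the factors `√ρ` and `c (U ⊗ 1) √ρ`, the phase `c` making the overlap nonnegative.
  have h1 : (s * sᴴ) = ρ := by rw [hsH, hss]
  have h2 : (c • (U ⊗ₖ (1 : Matrix B B ℂ) * s)) * (c • (U ⊗ₖ (1 : Matrix B B ℂ) * s))ᴴ =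
      perturb U ρ := by
    rw [conjTranspose_smul, Matrix.smul_mul, Matrix.mul_smul, smul_smul, hcc, one_smul,
      conjTranspose_mul, hsH, perturb, ← hss]
    simp only [mul_assoc]
  have h3 := trace_mul_le_rootFidelity h1 h2
  rw [← trace_conjTranspose_re, conjTranspose_mul, conjTranspose_conjTranspose, Matrix.smul_mul,
    hsH, mul_assoc, hss, trace_smul, ← hz, smul_eq_mul, ← hcz, Complex.ofReal_re] at h3
  exact h3

/-- Every state has overlap at least `|∑ λ_k| / d` with some unitary in `Λ`: the diagonal unitaries
obtained by cyclic shifts of the spectrum add up to the scalar `∑ λ_k`. -/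
lemma exists_norm_trace_ge [Nonempty A] (hunit : ∀ k, ‖lam k‖ = 1)
    {ρ : Matrix (A × B) (A × B) ℂ} (hρ : ρ.trace = 1) :
    ∃ U ∈ unitariesWithSpectrum lam,
      ‖∑ k, lam k‖ / Fintype.card A ≤ ‖(U ⊗ₖ (1 : Matrix B B ℂ) * ρ).trace‖ := by
  have : NeZero (Fintype.card A) := ⟨Fintype.card_ne_zero⟩
  let U : Fin (Fintype.card A) → Matrix A A ℂ := fun s =>
    diagonal fun a => lam (Fintype.equivFin A a + s)
  have hU : ∀ s, U s ∈ unitariesWithSpectrum lam := fun s => by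
    refine ⟨?_, ?_⟩
    · rw [mem_unitaryGroup_iff, star_eq_conjTranspose, diagonal_conjTranspose,
        diagonal_mul_diagonal, ← diagonal_one]
      congr 1
      ext a
      simp [Complex.mul_conj, Complex.normSq_eq_norm_sq, hunit]
    · rw [spectrum_diagonal]
      exact ((Equiv.addRight s).surjective.comp (Fintype.equivFin A).surjective).range_comp lam
  have hsum : ∑ s, U s = (∑ k, lam k) • (1 : Matrix A A ℂ) := by
    ext a b
    rw [Matrix.sum_apply]
    by_cases hab : a = b
    · subst hab
      simp only [U, diagonal_apply_eq, Matrix.smul_apply, one_apply_eq, smul_eq_mul, mul_one]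
      exact Equiv.sum_comp (Equiv.addLeft (Fintype.equivFin A a)) lam
    · simp [U, hab]
  have htr : ∑ s, (U s ⊗ₖ (1 : Matrix B B ℂ) * ρ).trace = ∑ k, lam k := by
    have hk : ∑ s, U s ⊗ₖ (1 : Matrix B B ℂ) = (∑ s, U s) ⊗ₖ (1 : Matrix B B ℂ) := by
      ext x y
      simp [Matrix.sum_apply, Finset.sum_mul]
    rw [← trace_sum, ← Finset.sum_mul, hk, hsum, smul_kronecker, one_kronecker_one,
      Matrix.smul_mul, one_mul, trace_smul, hρ, smul_eq_mul, mul_one]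
  by_contra! hcon
  have h1 : ‖∑ k, lam k‖ ≤ ∑ s, ‖(U s ⊗ₖ (1 : Matrix B B ℂ) * ρ).trace‖ :=
    htr ▸ norm_sum_le _ _
  have h2 : ∑ s, ‖(U s ⊗ₖ (1 : Matrix B B ℂ) * ρ).trace‖ <
      ∑ _s : Fin (Fintype.card A), ‖∑ k, lam k‖ / Fintype.card A :=
    Finset.sum_lt_sum_of_nonempty Finset.univ_nonempty fun s _ => hcon _ (hU s)
  have h3 : (Fintype.card A : ℝ) ≠ 0 := Nat.cast_ne_zero.2 Fintype.card_ne_zero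
  rw [Finset.sum_const, Finset.card_univ, Fintype.card_fin, nsmul_eq_mul,
    mul_div_cancel₀ _ h3] at h2
  linarith

lemma discordOfResponse_le_of_isState [Nonempty A] (hlam : Function.Injective lam)
    (hunit : ∀ k, ‖lam k‖ = 1) {ρ : Matrix (A × B) (A × B) ℂ} (hρ : IsState ρ) :
    discordOfResponse lam ρ ≤ 1 - ‖∑ k, lam k‖ / Fintype.card A := by
  obtain ⟨U, hU, h⟩ := exists_norm_trace_ge (lam := lam) hunit hρ.2
  have h1 := norm_trace_le_rootFidelity hρ.1 U
  have h2 := rootFidelity_le_one_sub_discord hlam hunit hρ.1 hU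
  linarith

lemma IsMaximallyEntangled.reducedState_eq [Nonempty A] {φ : EuclideanSpace ℂ (A × B)}
    (hφ : IsMaximallyEntangled φ) :
    reducedState φ = ((1 / Fintype.card A : ℝ) : ℂ) • (1 : Matrix A A ℂ) := by
  obtain ⟨e, f, hf, rfl⟩ := hφ
  have hV := colMatrix_mem_unitaryGroup_iff.2 e.orthonormal
  let F : Matrix B A ℂ := of fun b a => f a b
  have hF : Fᴴ * F = 1 := by
    rw [orthonormal_iff_ite] at hf
    ext i j
    rw [one_apply, ← hf]
    simp [F, mul_apply, PiLp.inner_apply, mul_comm]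
  have hc : coeffMatrix (∑ i, tensorVec (e i) (f i)) = colMatrix e * Fᵀ := by
    ext a b
    simp [coeffMatrix, tensorVec, colMatrix, F, mul_apply]
  have hF' : Fᵀ * Fᵀᴴ = 1 := by
    have := congrArg transpose hF
    rw [transpose_mul, transpose_one] at this
    exact this
  rw [reducedState_real_smul, reducedState, hc, conjTranspose_mul, Matrix.mul_assoc,
    ← Matrix.mul_assoc Fᵀ, hF', Matrix.one_mul, mul_conjTranspose_self_of_mem hV]
  congr 2
  rw [div_pow, one_pow, Real.sq_sqrt (Nat.cast_nonneg _)]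

lemma IsMaximallyEntangled.norm_eq_one [Nonempty A] {φ : EuclideanSpace ℂ (A × B)}
    (hφ : IsMaximallyEntangled φ) : ‖φ‖ = 1 := by
  have h := norm_sq_eq_trace_reducedState φ
  have h3 : (Fintype.card A : ℝ) ≠ 0 := Nat.cast_ne_zero.2 Fintype.card_ne_zero
  rw [hφ.reducedState_eq, trace_smul, trace_one, smul_eq_mul, ← Complex.ofReal_natCast,
    ← Complex.ofReal_mul, Complex.ofReal_re, one_div, inv_mul_cancel₀ h3] at h
  nlinarith [norm_nonneg φ]

lemma trace_of_mem_unitariesWithSpectrum (hlam : Function.Injective lam)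
    (hunit : ∀ k, ‖lam k‖ = 1) {U : Matrix A A ℂ} (hU : U ∈ unitariesWithSpectrum lam) :
    U.trace = ∑ k, lam k := by
  obtain ⟨V, hV, rfl⟩ := (mem_unitariesWithSpectrum_iff hlam hunit).1 hU
  rw [trace_mul_comm, ← mul_assoc, conjTranspose_mul_self_of_mem hV, one_mul, spectrumMatrix,
    trace_diagonal]
  exact (Fintype.equivFin A).sum_comp lam

lemma IsMaximallyEntangled.discordOfResponse_eq [Nonempty A] (hlam : Function.Injective lam)
    (hunit : ∀ k, ‖lam k‖ = 1) {φ : EuclideanSpace ℂ (A × B)} (hφ : IsMaximallyEntangled φ) :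
    discordOfResponse lam (ketbra φ) = 1 - ‖∑ k, lam k‖ / Fintype.card A := by
  obtain ⟨U, hU, h⟩ := (isGreatest_maxOverlap hlam hunit (reducedState φ)).1
  rw [discordOfResponse_ketbra hφ.norm_eq_one, ← h]
  simp only
  rw [hφ.reducedState_eq, Matrix.mul_smul, mul_one, trace_smul,
    trace_of_mem_unitariesWithSpectrum hlam hunit hU, norm_smul]
  simp [div_eq_inv_mul]

lemma IsMaximallyEntangled.isGreatest_discordOfResponse [Nonempty A]
    (hlam : Function.Injective lam) (hunit : ∀ k, ‖lam k‖ = 1) {φ : EuclideanSpace ℂ (A × B)}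
    (hφ : IsMaximallyEntangled φ) :
    IsGreatest ((fun ρ : Matrix (A × B) (A × B) ℂ => discordOfResponse lam ρ) '' {ρ | IsState ρ})
      (discordOfResponse lam (ketbra φ)) := by
  refine ⟨⟨_, isState_ketbra hφ.norm_eq_one, rfl⟩, ?_⟩
  rintro _ ⟨ρ, hρ, rfl⟩
  rw [hφ.discordOfResponse_eq hlam hunit]
  exact discordOfResponse_le_of_isState hlam hunit hρ

lemma sum_harmonicSpectrum {d : ℕ} (hd : 2 ≤ d) : ∑ k, harmonicSpectrum d k = 0 := by
  have hprim := Complex.isPrimitiveRoot_exp d (by omega)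
  rw [← hprim.geom_sum_eq_zero (by omega), ← Fin.sum_univ_eq_sum_range]
  refine Finset.sum_congr rfl fun k _ => ?_
  rw [harmonicSpectrum, ← Complex.exp_nat_mul]
  congr 1
  ring

lemma exists_isMaximallyEntangled (h : Fintype.card A ≤ Fintype.card B) :
    ∃ φ : EuclideanSpace ℂ (A × B), IsMaximallyEntangled φ := by
  obtain ⟨g⟩ := Function.Embedding.nonempty_of_card_le h
  exact ⟨_, EuclideanSpace.basisFun A ℂ, fun a => EuclideanSpace.basisFun B ℂ (g a),
    (EuclideanSpace.basisFun B ℂ).orthonormal.comp g g.injective, rfl⟩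
end
end
end BuresDiscord

theorem mainTheorem4 {A B : Type*} [Fintype A] [DecidableEq A] [Nonempty A]
    [Fintype B] [DecidableEq B] [Nonempty B]
    (lam : Fin (Fintype.card A) → ℂ) (hlam : Function.Injective lam) (hunit : ∀ k, ‖lam k‖ = 1) :
    -- the maximum in the definition exists, and the values lie in `[0, 1]`
    (∀ ρ : Matrix (A × B) (A × B) ℂ, IsState ρ →
      IsGreatest ((fun U => rootFidelity ρ (perturb U ρ)) ''
          unitariesWithSpectrum lam)
        (1 - discordOfResponse lam ρ) ∧
      0 ≤ discordOfResponse lam ρ ∧ discordOfResponse lam ρ ≤ 1) ∧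
    -- I) faithfulness
    (∀ ρ : Matrix (A × B) (A × B) ℂ, IsState ρ →
      (discordOfResponse lam ρ = 0 ↔ IsClassicalQuantum ρ)) ∧
    -- II) invariance under local unitaries
    (∀ ρ : Matrix (A × B) (A × B) ℂ, IsState ρ →
      ∀ V ∈ Matrix.unitaryGroup A ℂ, ∀ W ∈ Matrix.unitaryGroup B ℂ,
        discordOfResponse lam
            (V ⊗ₖ W * ρ * (V ⊗ₖ W).conjTranspose) =
          discordOfResponse lam ρ) ∧
    -- III) monotonicity under quantum channels on the second subsystem
    (∀ ρ : Matrix (A × B) (A × B) ℂ, IsState ρ →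
      ∀ (C : Type*) [Fintype C] [DecidableEq C] (Φ : Matrix B B ℂ →ₗ[ℂ] Matrix C C ℂ),
        IsCPTP Φ →
          discordOfResponse lam (ampliation Φ ρ) ≤
            discordOfResponse lam ρ) ∧
    -- IV) on pure states it is an entanglement monotone
    IsPureEntanglementMonotone
      (fun φ : EuclideanSpace ℂ (A × B) =>
        discordOfResponse lam (ketbra φ)) ∧
    -- relation with the entanglement of response on pure states
    (∀ φ : EuclideanSpace ℂ (A × B), ‖φ‖ = 1 →
      (∀ U ∈ unitariesWithSpectrum (A := A) lam,
        fidelity (ketbra φ)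
            (perturb U (ketbra φ)) =
          ‖inner ℂ φ (Matrix.toEuclideanLin (U ⊗ₖ (1 : Matrix B B ℂ)) φ)‖ ^ 2) ∧
      IsGreatest ((fun U => fidelity (ketbra φ)
            (perturb U (ketbra φ))) ''
          unitariesWithSpectrum lam)
        (1 - entanglementOfResponse lam φ) ∧
      0 ≤ entanglementOfResponse lam φ ∧
      entanglementOfResponse lam φ ≤ 1 ∧
      discordOfResponse lam (ketbra φ) =
        1 - Real.sqrt (1 - entanglementOfResponse lam φ)) ∧
    StrictMonoOn (fun x : ℝ => 1 - Real.sqrt (1 - x)) (Set.Icc 0 1) ∧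
    -- the maximum over all states is attained at the maximally entangled states
    (∀ φ : EuclideanSpace ℂ (A × B), IsMaximallyEntangled φ →
      IsGreatest ((fun ρ : Matrix (A × B) (A × B) ℂ => discordOfResponse lam ρ) ''
          {ρ | IsState ρ})
        (discordOfResponse lam (ketbra φ))) ∧
    -- for the harmonic spectrum this maximum is `1`
    (2 ≤ Fintype.card A → lam = harmonicSpectrum (Fintype.card A) →
      (∀ φ : EuclideanSpace ℂ (A × B), IsMaximallyEntangled φ →
        discordOfResponse lam (ketbra φ) = 1) ∧
      (Fintype.card A ≤ Fintype.card B →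
        IsGreatest ((fun ρ : Matrix (A × B) (A × B) ℂ => discordOfResponse lam ρ) ''
          {ρ | IsState ρ}) 1)) := by
  refine ⟨fun ρ hρ => ⟨isGreatest_rootFidelity hlam hunit hρ.1,
      discordOfResponse_nonneg hlam hunit hρ, discordOfResponse_le_one hlam hunit hρ⟩,
    fun ρ hρ => discordOfResponse_eq_zero_iff hlam hunit hρ,
    fun ρ hρ V hV W hW => discordOfResponse_conj hlam hunit hρ.1 hV hW,
    fun ρ hρ C _ _ Φ hΦ => hΦ.discordOfResponse_ampliation_le hlam hunit hρ.1,
    isPureEntanglementMonotone hlam hunit, fun φ hφ => ?_, strictMonoOn_one_sub_sqrt,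
    fun φ hφ => hφ.isGreatest_discordOfResponse hlam hunit, fun h2 hharm => ?_⟩
  · have hE := one_sub_entanglementOfResponse hlam hunit hφ
    have h0 := discordOfResponse_nonneg hlam hunit (isState_ketbra hφ)
    have h1 := discordOfResponse_le_one hlam hunit (isState_ketbra hφ)
    refine ⟨fun U _ => fidelity_ketbra_perturb hφ U,
      hE ▸ isGreatest_fidelity hlam hunit (isState_ketbra hφ).1, by nlinarith, by nlinarith, ?_⟩
    rw [hE, Real.sqrt_sq (by linarith)]
    ring
  · have hone : ∀ φ : EuclideanSpace ℂ (A × B), IsMaximallyEntangled φ →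
        discordOfResponse lam (ketbra φ) = 1 := fun φ hφ => by
      rw [hφ.discordOfResponse_eq hlam hunit, hharm, sum_harmonicSpectrum h2]
      simp
    refine ⟨hone, fun hAB => ?_⟩
    obtain ⟨φ, hφ⟩ := exists_isMaximallyEntangled hAB
    exact hone φ hφ ▸ hφ.isGreatest_discordOfResponse hlam hunit
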